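/- Let $\mathfrak g\oplus\mathfrak t^2$ be the real $8$-dimensional Lie algebra with basis $\alpha^i,\beta_i$ ($0\le i\le 3$) whose only nonzero brackets are $[\beta_i,\beta_j]=\sum_k\varepsilon_{ijk}\alpha^k$ for $i,j,k\in\{1,2,3\}$, with the invariant symmetric pairing of signature $(4,4)$ given by $(\alpha^i,\beta_j)=\delta^i_j$, $(\alpha^i,\alpha^j)=(\beta_i,\beta_j)=0$. Let $G\times\mathbb R^2$ be its simply connected Lie group, in exponential coordinates $x\cdot y=x+y+\tfrac12[x,y]$, let $\Gamma\times\mathbb Z^2$ be the subgroup generated by the integral combinations of the $\alpha^i$ and by the integral combinations of the $\beta_i$, and let $X\times T^2=(\Gamma\times\mathbb Z^2)\backslash(G\times\mathbb R^2)$. For $a\in\mathfrak d:=(\mathfrak g\oplus\mathfrak t^2)\otimes\mathbb C$ let $a(z)=\sum_{n\in\mathbb Z}a_{(n)}z^{-n-1}$ (even) and $\bar a(z)=\sum_{n\in\mathbb Z}\bar a_{(n)}z^{-n-1}$ (odd) be the currents, linear in $a$, of the affine Lie superalgebra at level one, $$[a_{(m)},b_{(n)}]=[a,b]_{(m+n)}+m\,(a,b)\,\delta_{m,-n},\quad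 [a_{(m)},\bar b_{(n)}]=\overline{[a,b]}_{(m+n)},\quad [\bar a_{(m)},\bar b_{(n)}]=(a,b)\,\delta_{m+n,-1}.$$ Let $\mathscr H\otimes\mathscr H_{T^2}$ be the module induced from $C^\infty(X\times T^2,\mathbb C)$, on which $a_{(n)}$ $(n>0)$ and $\bar a_{(n)}$ $(n\ge0)$ act by zero and $a_{(0)}$ acts by the differential of the action of $G\times\mathbb R^2$ by right translations; it is $\mathbb Z/2$-graded with $C^\infty(X\times T^2,\mathbb C)$ even. Let $\mathscr J$ be a left-invariant complex structure on $X\times T^2$ (a smooth endomorphism of the tangent bundle, constant in the trivialization of the tangent bundle by left-invariant vector fields, with $\mathscr J^2=-1$ and vanishing Nijenhuis tensor) that is orthogonal for the left-invariant metric defined by $(\cdot\,,\cdot)$. Let $\mathfrak l,\overline{\mathfrak l}\subset\mathfrak d$ be the $\pm\sqrt{-1}$-eigenspaces of $\mathscr J$. Then: 1. $(\mathfrak d,\mathfrak l,\overline{\mathfrak l})$ is a Manin triple: $(\cdot\,,\cdot)$ is a nondegenerate invariant symmetric form on $\mathfrak d$, and $\mathfrak d=\mathfrak l\oplus\overline{\mathfrak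 l}$ with $\mathfrak l,\overline{\mathfrak l}$ isotropic Lie subalgebras. 2. There are unique fields $L,J$ (even) and $G^+,G^-$ (odd) on $\mathscr H\otimes\mathscr H_{T^2}$, belonging to the vertex superalgebra of fields generated by the currents, that satisfy the operator product expansions of the $N=2$ superconformal algebra of central charge $c=12$, namely: $L$ is a Virasoro field of central charge $c$; $J$ and $G^\pm$ are primary for $L$ of conformal weights $1$ and $\tfrac32$; $$J(z)J(w)\sim\frac{c/3}{(z-w)^2},\qquad J(z)G^\pm(w)\sim\pm\frac{G^\pm(w)}{z-w},\qquad G^\pm(z)G^\pm(w)\sim0,$$ $$G^+(z)G^-(w)\sim\frac{L(w)+\frac12\partial J(w)}{z-w}+\frac{J(w)}{(z-w)^2}+\frac{c/3}{(z-w)^3};$$ and such that, for every basis $e_1,\dots,e_4$ of $\mathfrak l$ with dual basis $e^1,\dots,e^4$ of $\overline{\mathfrak l}$ (that is, $(e_i,e^j)=\delta_i^j$), the superfield $J(z)+\theta\,(G^-(z)-G^+(z))$ equals $\sum_i\bar e^i\bar e_i$, i.e. $$J=\sum_i{:}\bar e^i\bar e_i{:},\qquad G^--G^+=\sum_i\left({:}e^i\bar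 e_i{:}-{:}\bar e^ie_i{:}\right).$$ -/

import Mathlib

open scoped TensorProduct ContDiff

noncomputable section

namespace DoubledTorus

/-! ### The Lie algebra `𝔤 ⊕ 𝔱²`

Index `0` is the direction of the auxiliary torus, indices `1, 2, 3` are those of `𝔤`.
A vector `(a, b)` stands for `∑ i, a i • αⁱ + b i • βᵢ`. -/

/-- The real `8`-dimensional vector space underlying `𝔤 ⊕ 𝔱²`. -/
def DLie : Type := (Fin 4 → ℝ) × (Fin 4 → ℝ)

instance : NormedAddCommGroup DLie :=
  inferInstanceAs (NormedAddCommGroup ((Fin 4 → ℝ) × (Fin 4 → ℝ)))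

instance : NormedSpace ℝ DLie :=
  inferInstanceAs (NormedSpace ℝ ((Fin 4 → ℝ) × (Fin 4 → ℝ)))

instance : FiniteDimensional ℝ DLie :=
  inferInstanceAs (FiniteDimensional ℝ ((Fin 4 → ℝ) × (Fin 4 → ℝ)))

/-- The covector `det(v, w, ·)`, where `det` is extended by zero in the direction `0`;
its `k`-th component is `∑ i j, ε_{ijk} vⁱ wʲ`. -/
def detForm (v w : Fin 4 → ℝ) : Fin 4 → ℝ :=
  ![0, v 2 * w 3 - v 3 * w 2, v 3 * w 1 - v 1 * w 3, v 1 * w 2 - v 2 * w 1]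

/-- The only nonzero brackets of basis vectors are `[βᵢ, βⱼ] = ε_{ijk} αᵏ`. -/
instance : Bracket DLie DLie where
  bracket x y := ((detForm x.2 y.2, 0) : (Fin 4 → ℝ) × (Fin 4 → ℝ))

theorem bracket_def (x y : DLie) :
    ⁅x, y⁆ = (((detForm x.2 y.2, 0) : (Fin 4 → ℝ) × (Fin 4 → ℝ)) : DLie) := rfl

theorem detForm_add_left (u v w : Fin 4 → ℝ) :
    detForm (u + v) w = detForm u w + detForm v w := by
  funext k; fin_cases k <;> simp [detForm] <;> ring

theorem detForm_add_right (u v w : Fin 4 → ℝ) :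
    detForm u (v + w) = detForm u v + detForm u w := by
  funext k; fin_cases k <;> simp [detForm] <;> ring

theorem detForm_smul_right (t : ℝ) (u v : Fin 4 → ℝ) :
    detForm u (t • v) = t • detForm u v := by
  funext k; fin_cases k <;> simp [detForm] <;> ring

theorem detForm_self (v : Fin 4 → ℝ) : detForm v v = 0 := by
  funext k; fin_cases k <;> simp [detForm] <;> ring

theorem detForm_zero_left (v : Fin 4 → ℝ) : detForm 0 v = 0 := by
  funext k; fin_cases k <;> simp [detForm]

theorem detForm_zero_right (v : Fin 4 → ℝ) : detForm v 0 = 0 := by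
  funext k; fin_cases k <;> simp [detForm]

instance : LieRing DLie where
  add_lie x y z := by
    refine Prod.ext (detForm_add_left _ _ _) (add_zero _).symm
  lie_add x y z := by
    refine Prod.ext (detForm_add_right _ _ _) (add_zero _).symm
  lie_self x := Prod.ext (detForm_self _) rfl
  leibniz_lie x y z := by
    refine Prod.ext ?_ (add_zero _).symm
    change detForm x.2 0 = detForm 0 z.2 + detForm y.2 0
    simp [detForm_zero_left, detForm_zero_right]

instance : LieAlgebra ℝ DLie where
  lie_smul t _ _ := Prod.ext (detForm_smul_right _ _ _) (smul_zero t).symm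

/-- The invariant pairing of signature `(4, 4)`: `(αⁱ, βⱼ) = (βⱼ, αⁱ) = δⁱⱼ`, all other
pairings of basis vectors being zero. -/
def pairing : LinearMap.BilinForm ℝ DLie :=
  LinearMap.mk₂ ℝ (fun x y => ∑ i, (x.1 i * y.2 i + x.2 i * y.1 i))
    (fun x x' y => by
      rw [← Finset.sum_add_distrib]
      refine Finset.sum_congr rfl fun i _ => ?_
      change (x.1 i + x'.1 i) * y.2 i + (x.2 i + x'.2 i) * y.1 i = _
      ring)
    (fun c x y => by
      rw [smul_eq_mul, Finset.mul_sum]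
      refine Finset.sum_congr rfl fun i _ => ?_
      change (c * x.1 i) * y.2 i + (c * x.2 i) * y.1 i = _
      ring)
    (fun x y y' => by
      rw [← Finset.sum_add_distrib]
      refine Finset.sum_congr rfl fun i _ => ?_
      change x.1 i * (y.2 i + y'.2 i) + x.2 i * (y.1 i + y'.1 i) = _
      ring)
    (fun c x y => by
      rw [smul_eq_mul, Finset.mul_sum]
      refine Finset.sum_congr rfl fun i _ => ?_
      change x.1 i * (c * y.2 i) + x.2 i * (c * y.1 i) = _
      ring)

/-- The complexification of `𝔤 ⊕ 𝔱²`. -/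
abbrev DLieC : Type := ℂ ⊗[ℝ] DLie

/-- The complex bilinear extension of the pairing. -/
def pairingC : LinearMap.BilinForm ℂ DLieC := LinearMap.BilinForm.baseChange ℂ pairing

/-! ### The group `G × ℝ²`, its lattice, and the nilmanifold `X × T²` -/

/-- The simply connected group `G × ℝ²`, presented in exponential coordinates. -/
@[ext]
structure DGroup : Type where
  /-- the exponential map, a global chart -/
  exp ::
  /-- the inverse of the exponential map -/
  log : DLie

/-- `(v*, v) (w*, w) = (v* + w* + ½ det(v, w, ·), v + w)`. -/
instance : Mul DGroup where
  mul g h := ⟨g.log + h.log + (1 / 2 : ℝ) • ⁅g.log, h.log⁆⟩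

instance : One DGroup where
  one := ⟨0⟩

instance : Inv DGroup where
  inv g := ⟨-g.log⟩

theorem mul_log (g h : DGroup) :
    (g * h).log = g.log + h.log + (1 / 2 : ℝ) • ⁅g.log, h.log⁆ := rfl

theorem lie_lie_eq_zero (x y z : DLie) : ⁅⁅x, y⁆, z⁆ = 0 :=
  Prod.ext (detForm_zero_left _) rfl

theorem lie_lie_eq_zero' (x y z : DLie) : ⁅x, ⁅y, z⁆⁆ = 0 :=
  Prod.ext (detForm_zero_right _) rfl

instance : Group DGroup :=
  Group.ofLeftAxioms
    (fun g h k => by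
      refine DGroup.ext ?_
      simp only [mul_log, add_lie, lie_add, smul_lie, lie_smul, lie_lie_eq_zero,
        lie_lie_eq_zero', smul_add, smul_zero, add_zero]
      abel)
    (fun g => by
      refine DGroup.ext ?_
      change (0 : DLie) + g.log + (1 / 2 : ℝ) • ⁅(0 : DLie), g.log⁆ = g.log
      simp)
    (fun g => by
      refine DGroup.ext ?_
      change -g.log + g.log + (1 / 2 : ℝ) • ⁅-g.log, g.log⁆ = 0
      simp)

/-- The discrete co-compact subgroup `Γ × ℤ²`, generated by the integral vectors of
`V ⊕ ℝ` and of its dual. -/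
def lattice : Subgroup DGroup :=
  Subgroup.closure
    {g | ∃ k : Fin 4 → ℤ,
      g.log.1 = (fun i => (k i : ℝ)) ∧ g.log.2 = 0 ∨
      g.log.1 = 0 ∧ g.log.2 = (fun i => (k i : ℝ))}

/-- The nilmanifold `X × T² = (Γ × ℤ²) \ (G × ℝ²)`. -/
abbrev Nilmanifold : Type := Quotient (QuotientGroup.rightRel lattice)

/-- The projection `G × ℝ² → X × T²`. -/
def proj (g : DGroup) : Nilmanifold := Quotient.mk _ g

/-- The right action of `G × ℝ²` on `X × T²`. -/
def rightTranslate (h : DGroup) : Nilmanifold → Nilmanifold :=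
  Quotient.map (fun g => g * h) (by
    intro a b hab
    change QuotientGroup.rightRel lattice _ _
    rw [QuotientGroup.rightRel_apply]
    have h' : QuotientGroup.rightRel lattice a b := hab
    rw [QuotientGroup.rightRel_apply] at h'
    simpa [mul_assoc] using h')

theorem rightTranslate_proj (h g : DGroup) : rightTranslate h (proj g) = proj (g * h) := rfl

/-- `C^∞(X × T²)`: complex functions on the nilmanifold that are smooth after pull back along
the covering `G × ℝ² → X × T²`. -/
def SmoothFunctions : Submodule ℂ (Nilmanifold → ℂ) where
  carrier := {f | ContDiff ℝ ∞ (fun x : DLie => f (proj ⟨x⟩))}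
  add_mem' {f g} hf hg := by
    have hf' : ContDiff ℝ ∞ (fun x : DLie => f (proj ⟨x⟩)) := hf
    have hg' : ContDiff ℝ ∞ (fun x : DLie => g (proj ⟨x⟩)) := hg
    exact hf'.add hg'
  zero_mem' := by
    change ContDiff ℝ ∞ (fun _ : DLie => (0 : ℂ))
    exact contDiff_const
  smul_mem' c f hf := by
    have hf' : ContDiff ℝ ∞ (fun x : DLie => f (proj ⟨x⟩)) := hf
    exact hf'.const_smul c

theorem hasDerivAt_rightTranslate (f : SmoothFunctions) (X x : DLie) :
    HasDerivAt (fun t : ℝ => f.1 (rightTranslate ⟨t • X⟩ (proj ⟨x⟩)))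
      (fderiv ℝ (fun y : DLie => f.1 (proj ⟨y⟩)) x (X + (1 / 2 : ℝ) • ⁅x, X⁆)) 0 := by
  have h1 : HasDerivAt (fun t : ℝ => x + t • (X + (1 / 2 : ℝ) • ⁅x, X⁆))
      (X + (1 / 2 : ℝ) • ⁅x, X⁆) 0 := by
    simpa using ((hasDerivAt_id (0 : ℝ)).smul_const (X + (1 / 2 : ℝ) • ⁅x, X⁆)).const_add x
  have hf : ContDiff ℝ ∞ (fun y : DLie => f.1 (proj ⟨y⟩)) := f.2
  have h2 : HasFDerivAt (fun y : DLie => f.1 (proj ⟨y⟩))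
      (fderiv ℝ (fun y : DLie => f.1 (proj ⟨y⟩)) x)
      (x + (0 : ℝ) • (X + (1 / 2 : ℝ) • ⁅x, X⁆)) := by
    simpa using (hf.differentiable (by simp) x).hasFDerivAt
  have h3 := h2.comp_hasDerivAt (0 : ℝ) h1
  refine h3.congr_of_eventuallyEq (Filter.Eventually.of_forall fun t => ?_)
  change f.1 (proj ⟨x + t • X + (1 / 2 : ℝ) • ⁅x, t • X⁆⟩) =
    f.1 (proj ⟨x + t • (X + (1 / 2 : ℝ) • ⁅x, X⁆)⟩)
  rw [lie_smul, smul_add, smul_comm t (1 / 2 : ℝ), add_assoc]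

/-- The action of `X ∈ 𝔤 ⊕ 𝔱²` on `C^∞(X × T²)`, the differential of the action of `G × ℝ²`
by right translations. -/
def act (X : DLie) : SmoothFunctions →ₗ[ℂ] SmoothFunctions where
  toFun f := ⟨fun p => deriv (fun t : ℝ => f.1 (rightTranslate ⟨t • X⟩ p)) 0, by
    change ContDiff ℝ ∞ (fun x : DLie =>
      deriv (fun t : ℝ => f.1 (rightTranslate ⟨t • X⟩ (proj ⟨x⟩))) 0)
    have hf : ContDiff ℝ ∞ (fun y : DLie => f.1 (proj ⟨y⟩)) := f.2
    have h1 : ContDiff ℝ ∞ (fun x : DLie => X + (1 / 2 : ℝ) • ⁅x, X⁆) := by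
      have h2 : ContDiff ℝ ∞ (fun x : DLie => -⁅X, x⁆) :=
        (LinearMap.toContinuousLinearMap
          ((LieAlgebra.ad ℝ DLie X : DLie →ₗ[ℝ] DLie))).contDiff.neg
      have h3 : (fun x : DLie => -⁅X, x⁆) = fun x : DLie => ⁅x, X⁆ := by
        funext x; exact lie_skew x X
      rw [h3] at h2
      exact contDiff_const.add (h2.const_smul (1 / 2 : ℝ))
    have h4 : (fun x : DLie =>
        deriv (fun t : ℝ => f.1 (rightTranslate ⟨t • X⟩ (proj ⟨x⟩))) 0) =
        fun x : DLie =>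
          fderiv ℝ (fun y : DLie => f.1 (proj ⟨y⟩)) x (X + (1 / 2 : ℝ) • ⁅x, X⁆) :=
      funext fun x => (hasDerivAt_rightTranslate f X x).deriv
    rw [h4]
    exact (hf.fderiv_right (m := ∞) (by simp)).clm_apply h1⟩
  map_add' f g := by
    ext p
    induction p using Quotient.inductionOn with
    | h g' =>
      exact ((hasDerivAt_rightTranslate f X g'.log).add
        (hasDerivAt_rightTranslate g X g'.log)).deriv.trans
        (congrArg₂ (· + ·) (hasDerivAt_rightTranslate f X g'.log).deriv.symm
          (hasDerivAt_rightTranslate g X g'.log).deriv.symm)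
  map_smul' c f := by
    ext p
    induction p using Quotient.inductionOn with
    | h g' =>
      exact ((hasDerivAt_rightTranslate f X g'.log).const_smul c).deriv.trans
        (congrArg (c • ·) (hasDerivAt_rightTranslate f X g'.log).deriv.symm)

/-! ### Complex structures on `X × T²` -/

/-- The differential at `x` of left translation by `h`, in exponential coordinates. -/
def dLeft (h : DGroup) (x : DLie) : DLie →L[ℝ] DLie :=
  fderiv ℝ (fun y : DLie => (h * ⟨y⟩).log) x

/-- The pseudo-Riemannian metric of signature `(4, 4)` on the tangent bundle obtained from the
pairing on `𝔤 ⊕ 𝔱²` through the trivialization by left translations. -/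
def metric (x u v : DLie) : ℝ :=
  pairing (dLeft (DGroup.exp x)⁻¹ x u) (dLeft (DGroup.exp x)⁻¹ x v)

/-- A complex structure on `X × T²`: a smooth endomorphism `𝒥` of the tangent bundle with
`𝒥² = -1` and vanishing Nijenhuis tensor. A tensor field on `X × T²` is the same as a tensor
field on the covering group `G × ℝ²` that is invariant under the lattice. -/
structure IsComplexStructure (𝒥 : DLie → DLie →L[ℝ] DLie) : Prop where
  smooth : ContDiff ℝ ∞ 𝒥
  descends : ∀ γ ∈ lattice, ∀ x,
    dLeft γ x ∘L 𝒥 x = 𝒥 (γ * DGroup.exp x).log ∘L dLeft γ x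
  sq : ∀ x, 𝒥 x ∘L 𝒥 x = -ContinuousLinearMap.id ℝ DLie
  integrable : ∀ U V : DLie → DLie, ContDiff ℝ ∞ U → ContDiff ℝ ∞ V → ∀ x,
    VectorField.lieBracket ℝ (fun y => 𝒥 y (U y)) (fun y => 𝒥 y (V y)) x
      - 𝒥 x (VectorField.lieBracket ℝ (fun y => 𝒥 y (U y)) V x)
      - 𝒥 x (VectorField.lieBracket ℝ U (fun y => 𝒥 y (V y)) x)
      - VectorField.lieBracket ℝ U V x = 0

/-- Equivariance: in the trivialization of `T(X × T²)` by left-invariant vector fields, the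
endomorphism `𝒥` is constant, i.e. `𝒥` is invariant under all left translations of `G × ℝ²`. -/
def IsEquivariant (𝒥 : DLie → DLie →L[ℝ] DLie) : Prop :=
  ∀ (h : DGroup) (x : DLie), dLeft h x ∘L 𝒥 x = 𝒥 (h * DGroup.exp x).log ∘L dLeft h x

/-- `𝒥` is orthogonal for the metric. -/
def IsOrthogonal (𝒥 : DLie → DLie →L[ℝ] DLie) : Prop :=
  ∀ x u v : DLie, metric x (𝒥 x u) (𝒥 x v) = metric x u v

/-- The `ε`-eigenspace, in the complexified Lie algebra, of the endomorphism of `𝔤 ⊕ 𝔱²`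
given by `𝒥` at the identity. For `ε = i, -i` these are `𝔩` and `𝔩̄`. -/
def eigen (𝒥 : DLie → DLie →L[ℝ] DLie) (ε : ℂ) : Submodule ℂ DLieC :=
  Module.End.eigenspace (LinearMap.baseChange ℂ (𝒥 0 : DLie →ₗ[ℝ] DLie)) ε

/-- A Manin triple: a Lie algebra with a nondegenerate invariant symmetric bilinear form that is
the direct sum of two isotropic Lie subalgebras. -/
structure IsManinTriple {K 𝔡 : Type*} [Field K] [LieRing 𝔡] [LieAlgebra K 𝔡]
    (B : LinearMap.BilinForm K 𝔡) (𝔞 𝔟 : Submodule K 𝔡) : Prop where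
  symm : ∀ x y, B x y = B y x
  nondegenerate : B.Nondegenerate
  invariant : ∀ x y z, B ⁅x, y⁆ z = B x ⁅y, z⁆
  lie_mem_left : ∀ x ∈ 𝔞, ∀ y ∈ 𝔞, ⁅x, y⁆ ∈ 𝔞
  lie_mem_right : ∀ x ∈ 𝔟, ∀ y ∈ 𝔟, ⁅x, y⁆ ∈ 𝔟
  isotropic_left : ∀ x ∈ 𝔞, ∀ y ∈ 𝔞, B x y = 0
  isotropic_right : ∀ x ∈ 𝔟, ∀ y ∈ 𝔟, B x y = 0
  isCompl : IsCompl 𝔞 𝔟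

/-! ### Fields and operator product expansions -/

section Fields

variable {M : Type*} [AddCommGroup M] [Module ℂ M]

/-- A formal distribution `A(z) = ∑ₙ A₍ₙ₎ z⁻ⁿ⁻¹` with coefficients operators on `M`. -/
abbrev FormalDist (M : Type*) [AddCommGroup M] [Module ℂ M] : Type _ := ℤ → Module.End ℂ M

/-- `A(z)` is a field: `A(z) v` is a Laurent series for every `v`. -/
def IsQuantumField (A : FormalDist M) : Prop :=
  ∀ v : M, ∃ N : ℤ, ∀ n : ℤ, N ≤ n → A n v = 0

/-- The identity field. -/
def idField : FormalDist M := fun n => if n = -1 then LinearMap.id else 0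

/-- The derivative `∂A(z)`. -/
def dField (A : FormalDist M) : FormalDist M := fun n => (-n : ℂ) • A (n - 1)

/-- The sign `(-1)^{pq}`. -/
def koszul (p q : ZMod 2) : ℂ := if p = 1 ∧ q = 1 then -1 else 1

/-- The operator product expansion
`A(z) B(w) ~ C₀(w)/(z-w) + C₁(w)/(z-w)² + C₂(w)/(z-w)³ + ⋯`, with `C = [C₀, C₁, C₂, …]`, for
`A` of parity `p` and `B` of parity `q`: the super-commutator of `A(z)` and `B(w)` is
`∑ⱼ Cⱼ(w) ∂_w^j δ(z-w) / j!`, written out in modes. -/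
def HasOPE (p q : ZMod 2) (A B : FormalDist M) (C : List (FormalDist M)) : Prop :=
  ∀ m n : ℤ, A m * B n - koszul p q • (B n * A m) =
    ∑ j : Fin C.length, ((Ring.choose m (j : ℕ) : ℤ) : ℂ) • C.get j (m + n - (j : ℕ))

/-- The `n`-th mode, applied to `v`, of the `k`-th product `A₍ₖ₎B` of two fields of parities
`p` and `q`: the residue at `z` of
`i_{z,w}(z-w)^k A(z) B(w) - (-1)^{pq} i_{w,z}(z-w)^k B(w) A(z)`.
The sum is finite when `A` and `B` are fields. -/
def nthProd (p q : ZMod 2) (k : ℤ) (A B : FormalDist M) (n : ℤ) (v : M) : M :=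
  ∑ᶠ j : ℕ, ((-1 : ℂ) ^ j * ((Ring.choose k j : ℤ) : ℂ)) •
    (A (k - j) (B (n + j) v) - (koszul p q * (-1 : ℂ) ^ k) • B (n + k - j) (A j v))

/-- The normally ordered product `:A(z)B(z):`. -/
def normalOrd (p q : ZMod 2) (A B : FormalDist M) (n : ℤ) (v : M) : M :=
  nthProd p q (-1) A B n v

/-- Given fields `even a` and `odd a` on `M`, the vertex super-algebra of fields on `M` that they
generate: the smallest space of fields that contains them and the identity field and is closed
under all `k`-th products. `MemGenerated even odd p A` says that `A` is in its part of
parity `p`. -/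
inductive MemGenerated {ι : Type*} (even odd : ι → FormalDist M) :
    ZMod 2 → FormalDist M → Prop
  | one : MemGenerated even odd 0 idField
  | even (a : ι) : MemGenerated even odd 0 (even a)
  | odd (a : ι) : MemGenerated even odd 1 (odd a)
  | add {p : ZMod 2} {A B : FormalDist M} : MemGenerated even odd p A →
      MemGenerated even odd p B → MemGenerated even odd p (A + B)
  | smul {p : ZMod 2} (c : ℂ) {A : FormalDist M} : MemGenerated even odd p A →
      MemGenerated even odd p (c • A)
  | prod {p q : ZMod 2} (k : ℤ) {A B C : FormalDist M} : MemGenerated even odd p A →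
      MemGenerated even odd q B → (∀ n v, C n v = nthProd p q k A B n v) →
      MemGenerated even odd (p + q) C

/-- All modes of `A` are operators of parity `p` for the `ℤ/2`-grading `S` of `M`. -/
def HasParity (S : ZMod 2 → Submodule ℂ M) (p : ZMod 2) (A : FormalDist M) : Prop :=
  ∀ n q, ∀ v ∈ S q, A n v ∈ S (p + q)

/-- Four formal distributions, candidates for the generators of the `N = 2` algebra. -/
structure N2Data (M : Type*) [AddCommGroup M] [Module ℂ M] where
  L : FormalDist M
  J : FormalDist M
  Gp : FormalDist M
  Gm : FormalDist M

/-- The fields `L`, `J` (even) and `G⁺`, `G⁻` (odd) make the super-space `M = S 0 ⊕ S 1` a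
representation of the `N = 2` super-conformal algebra of central charge `c`. -/
structure IsN2 (S : ZMod 2 → Submodule ℂ M) (c : ℂ) (D : N2Data M) : Prop where
  field_L : IsQuantumField D.L
  field_J : IsQuantumField D.J
  field_Gp : IsQuantumField D.Gp
  field_Gm : IsQuantumField D.Gm
  parity_L : HasParity S 0 D.L
  parity_J : HasParity S 0 D.J
  parity_Gp : HasParity S 1 D.Gp
  parity_Gm : HasParity S 1 D.Gm
  LL : HasOPE 0 0 D.L D.L [dField D.L, (2 : ℂ) • D.L, 0, (c / 2) • idField]
  LJ : HasOPE 0 0 D.L D.J [dField D.J, D.J]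
  LGp : HasOPE 0 1 D.L D.Gp [dField D.Gp, (3 / 2 : ℂ) • D.Gp]
  LGm : HasOPE 0 1 D.L D.Gm [dField D.Gm, (3 / 2 : ℂ) • D.Gm]
  JJ : HasOPE 0 0 D.J D.J [0, (c / 3) • idField]
  JGp : HasOPE 0 1 D.J D.Gp [D.Gp]
  JGm : HasOPE 0 1 D.J D.Gm [-D.Gm]
  GpGm : HasOPE 1 1 D.Gp D.Gm
    [D.L + (1 / 2 : ℂ) • dField D.J, D.J, (c / 3) • idField]
  GpGp : HasOPE 1 1 D.Gp D.Gp []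
  GmGm : HasOPE 1 1 D.Gm D.Gm []

end Fields

/-! ### The affine super-algebra and the space of states -/

/-- Generators of the affine Lie super-algebra: the modes `a₍ₙ₎` of the even currents
`a(z) = ∑ₙ a₍ₙ₎ z⁻ⁿ⁻¹` and `ā₍ₙ₎` (of degree `n + 1/2`) of the odd currents
`ā(z) = ∑ₙ ā₍ₙ₎ z⁻ⁿ⁻¹`. -/
inductive Gen : Type
  | cur (a : DLieC) (n : ℤ) : Gen
  | bar (a : DLieC) (n : ℤ) : Gen

/-- The parity of a generator. -/
def Gen.parity : Gen → ZMod 2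
  | .cur _ _ => 0
  | .bar _ _ => 1

/-- The defining relations: linearity in `a`, and the commutators at level one
`[a₍ₘ₎, b₍ₙ₎] = [a, b]₍ₘ₊ₙ₎ + m (a, b) δ_{m,-n}`, `[a₍ₘ₎, b̄₍ₙ₎]` the mode `m + n` of the odd
current of `[a, b]`, and `{ā₍ₘ₎, b̄₍ₙ₎} = (a, b) δ_{m + n, -1}`. -/
inductive AffineRel : FreeAlgebra ℂ Gen → FreeAlgebra ℂ Gen → Prop
  | cur_add (a b : DLieC) (n : ℤ) : AffineRel (FreeAlgebra.ι ℂ (.cur (a + b) n))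
      (FreeAlgebra.ι ℂ (.cur a n) + FreeAlgebra.ι ℂ (.cur b n))
  | cur_smul (c : ℂ) (a : DLieC) (n : ℤ) : AffineRel (FreeAlgebra.ι ℂ (.cur (c • a) n))
      (c • FreeAlgebra.ι ℂ (.cur a n))
  | bar_add (a b : DLieC) (n : ℤ) : AffineRel (FreeAlgebra.ι ℂ (.bar (a + b) n))
      (FreeAlgebra.ι ℂ (.bar a n) + FreeAlgebra.ι ℂ (.bar b n))
  | bar_smul (c : ℂ) (a : DLieC) (n : ℤ) : AffineRel (FreeAlgebra.ι ℂ (.bar (c • a) n))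
      (c • FreeAlgebra.ι ℂ (.bar a n))
  | cur_cur (a b : DLieC) (m n : ℤ) :
      AffineRel (FreeAlgebra.ι ℂ (.cur a m) * FreeAlgebra.ι ℂ (.cur b n)
          - FreeAlgebra.ι ℂ (.cur b n) * FreeAlgebra.ι ℂ (.cur a m))
        (FreeAlgebra.ι ℂ (.cur ⁅a, b⁆ (m + n))
          + algebraMap ℂ _ (if m + n = 0 then (m : ℂ) * pairingC a b else 0))
  | cur_bar (a b : DLieC) (m n : ℤ) :
      AffineRel (FreeAlgebra.ι ℂ (.cur a m) * FreeAlgebra.ι ℂ (.bar b n)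
          - FreeAlgebra.ι ℂ (.bar b n) * FreeAlgebra.ι ℂ (.cur a m))
        (FreeAlgebra.ι ℂ (.bar ⁅a, b⁆ (m + n)))
  | bar_bar (a b : DLieC) (m n : ℤ) :
      AffineRel (FreeAlgebra.ι ℂ (.bar a m) * FreeAlgebra.ι ℂ (.bar b n)
          + FreeAlgebra.ι ℂ (.bar b n) * FreeAlgebra.ι ℂ (.bar a m))
        (algebraMap ℂ _ (if m + n = -1 then pairingC a b else 0))

/-- The enveloping algebra of the affine Lie super-algebra, with the central element equal
to `1`. -/
def Envelope : Type := RingQuot AffineRel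

instance : Ring Envelope := inferInstanceAs (Ring (RingQuot AffineRel))

instance : Algebra ℂ Envelope := inferInstanceAs (Algebra ℂ (RingQuot AffineRel))

/-- A generator, as an element of the enveloping algebra. -/
def Gen.toEnvelope (x : Gen) : Envelope := RingQuot.mkAlgHom ℂ AffineRel (FreeAlgebra.ι ℂ x)

/-- The relations of the induced module: modes of positive degree annihilate `C^∞(X × T²)`, and
modes of degree zero act on it through `act`. -/
def inducedRelations : Submodule Envelope (Envelope ⊗[ℂ] SmoothFunctions) :=
  Submodule.span Envelope
    ({t | ∃ (a : DLieC) (n : ℤ) (f : SmoothFunctions), 0 < n ∧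
        t = (Gen.cur a n).toEnvelope ⊗ₜ[ℂ] f} ∪
     {t | ∃ (a : DLieC) (n : ℤ) (f : SmoothFunctions), 0 ≤ n ∧
        t = (Gen.bar a n).toEnvelope ⊗ₜ[ℂ] f} ∪
     {t | ∃ (X : DLie) (f : SmoothFunctions),
        t = (Gen.cur (1 ⊗ₜ[ℝ] X) 0).toEnvelope ⊗ₜ[ℂ] f - 1 ⊗ₜ[ℂ] act X f})

/-- The space of states `ℋ ⊗ ℋ_{T²}`: the module over the affine Lie super-algebra induced from
its subalgebra of non-negative degree acting on `C^∞(X × T²)`. -/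
def States : Type := (Envelope ⊗[ℂ] SmoothFunctions) ⧸ inducedRelations

instance : AddCommGroup States :=
  inferInstanceAs (AddCommGroup ((Envelope ⊗[ℂ] SmoothFunctions) ⧸ inducedRelations))

instance : Module Envelope States :=
  inferInstanceAs (Module Envelope ((Envelope ⊗[ℂ] SmoothFunctions) ⧸ inducedRelations))

instance : Module ℂ States :=
  inferInstanceAs (Module ℂ ((Envelope ⊗[ℂ] SmoothFunctions) ⧸ inducedRelations))

instance : IsScalarTower ℂ Envelope States :=
  inferInstanceAs
    (IsScalarTower ℂ Envelope ((Envelope ⊗[ℂ] SmoothFunctions) ⧸ inducedRelations))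

/-- The projection of `U ⊗ C^∞(X × T²)` onto the space of states. -/
def toStates : Envelope ⊗[ℂ] SmoothFunctions →ₗ[Envelope] States := inducedRelations.mkQ

/-- The `ℤ/2`-grading of the space of states: `C^∞(X × T²)` is even, and each odd mode changes
the parity. -/
def stateParity (p : ZMod 2) : Submodule ℂ States :=
  Submodule.span ℂ {v | ∃ (w : List Gen) (f : SmoothFunctions),
    (w.map Gen.parity).sum = p ∧
    v = (w.map Gen.toEnvelope).prod • toStates (1 ⊗ₜ[ℂ] f)}

/-- The even current `a(z)` acting on the space of states. -/
def current (a : DLieC) : FormalDist States := fun n =>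
  Algebra.lsmul ℂ ℂ States (Gen.cur a n).toEnvelope

/-- The odd current `ā(z)` acting on the space of states. -/
def oddCurrent (a : DLieC) : FormalDist States := fun n =>
  Algebra.lsmul ℂ ℂ States (Gen.bar a n).toEnvelope

/-- The `N = 2` data `D` on the space of states is generated by the super-field
`J(z,θ) = ∑ᵢ ēⁱ(z,θ) ēᵢ(z,θ)`, where `ā(z,θ) = ā(z) + θ a(z)`. Here `e` and `e'` are dual bases
of two subspaces of the Lie algebra (`e' i` is written `eⁱ`), and
`J(z,θ) = J(z) + θ (G⁻(z) - G⁺(z))`. -/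
def IsGeneratedBy (D : N2Data States) (e e' : Fin 4 → DLieC) : Prop :=
  (∀ n v, D.J n v = ∑ i, normalOrd 1 1 (oddCurrent (e' i)) (oddCurrent (e i)) n v) ∧
  (∀ n v, D.Gm n v - D.Gp n v =
    ∑ i, (normalOrd 0 1 (current (e' i)) (oddCurrent (e i)) n v
      - normalOrd 1 0 (oddCurrent (e' i)) (current (e i)) n v))

/-- The fields of `D` come from the vertex super-algebra `V((𝔤 ⊕ 𝔱²)_super)`, that is, they
belong to the vertex super-algebra of fields generated by the currents. -/
structure IsInAffineVertexAlgebra (D : N2Data States) : Prop where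
  mem_L : MemGenerated current oddCurrent 0 D.L
  mem_J : MemGenerated current oddCurrent 0 D.J
  mem_Gp : MemGenerated current oddCurrent 1 D.Gp
  mem_Gm : MemGenerated current oddCurrent 1 D.Gm

end DoubledTorus

/-!
Write `Z` for the centre. Since `𝒥` is skew for the metric, the Nijenhuis identity on central
vectors forces `𝒥` to map the derived algebra into `Z`, so `Z ∩ 𝒥Z` contains the derived algebra and
hence, the metric being invariant, its own orthogonal. Passing to `𝔩` and `𝔩̄`, one finds dual bases
`eᵢ`, `eⁱ` such that for every `i` one of `eᵢ`, `eⁱ` is central. The central ones form a family `w`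
and the other ones a dual family `d`, where `d k ∈ 𝔩` or `d k ∈ 𝔩̄` is recorded by a sign `σ k`.

All the fields are then polynomial of low degree in the currents of `w` and `d`, with central `w`.
The Kac–Todorov supercurrent `K` has the Virasoro field as half its square, and the zero mode of the
`U(1)` current `J` splits `K` into the components `G⁺`, `G⁻` of charge `±1`. By the super-Jacobi
identity all the operator product expansions follow from a few that involve `J` and `K`.

Uniqueness: `J` is prescribed, and its zero mode acts by `±1` on `G^±`, so it turns `G⁻ - G⁺` into
`-(G⁺ + G⁻)`; then `L` is read off the first-order pole of `G⁺(z)G⁻(w)`.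
-/

noncomputable section

namespace DoubledTorus

/-! ### Calculus of quantum fields -/

section FieldCalculus

open Filter

variable {M : Type*} [AddCommGroup M] [Module ℂ M]

theorem isQuantumField_iff_eventually {A : FormalDist M} :
    IsQuantumField A ↔ ∀ v, ∀ᶠ n : ℤ in atTop, A n v = 0 := by
  simp only [IsQuantumField, eventually_atTop]

variable (M) in
/-- The space of quantum fields on `M`, as a subspace of the formal distributions. -/
def quantumFields : Submodule ℂ (FormalDist M) where
  carrier := {A | IsQuantumField A}
  add_mem' {A B} hA hB := isQuantumField_iff_eventually.2 fun v => by
    filter_upwards [isQuantumField_iff_eventually.1 hA v,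
      isQuantumField_iff_eventually.1 hB v] with n hAn hBn
    simp [hAn, hBn]
  zero_mem' _ := ⟨0, fun _ _ => rfl⟩
  smul_mem' c A hA v := by
    obtain ⟨N, hN⟩ := hA v
    exact ⟨N, fun n hn => by simp [hN n hn]⟩

@[ext]
theorem quantumFields_ext {A B : quantumFields M} (h : ∀ n v, A.1 n v = B.1 n v) : A = B :=
  Subtype.ext (funext fun n => LinearMap.ext (h n))

theorem eventually_mode_apply_eq_zero (A : quantumFields M) (v : M) :
    ∀ᶠ n : ℤ in atTop, A.1 n v = 0 :=
  isQuantumField_iff_eventually.1 A.2 v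

theorem eventually_add_mode_apply_eq_zero (A : quantumFields M) (n : ℤ) (v : M) :
    ∀ᶠ j : ℕ in atTop, A.1 (n + j) v = 0 :=
  (tendsto_atTop_add_const_left _ n tendsto_natCast_atTop_atTop).eventually
    (eventually_mode_apply_eq_zero A v)

/-- Multiplication of a field by `w ^ r`. -/
def shift (r : ℤ) : quantumFields M →ₗ[ℂ] quantumFields M where
  toFun A := ⟨fun n => A.1 (n + r), fun v => by
    obtain ⟨N, hN⟩ := A.2 v
    exact ⟨N - r, fun n hn => hN _ (by omega)⟩⟩
  map_add' _ _ := rfl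
  map_smul' _ _ := rfl

@[simp] theorem shift_apply (r : ℤ) (A : quantumFields M) (n : ℤ) :
    (shift r A).1 n = A.1 (n + r) := rfl

theorem shift_shift (r s : ℤ) (A : quantumFields M) :
    shift r (shift s A) = shift (r + s) A := by
  ext n v; simp [add_assoc]

@[simp] theorem shift_zero (A : quantumFields M) : shift 0 A = A := by
  ext n v; simp

/-- The derivative `∂A(z)` of a field. -/
def der : quantumFields M →ₗ[ℂ] quantumFields M where
  toFun A := ⟨dField A.1, fun v => by
    obtain ⟨N, hN⟩ := A.2 v
    exact ⟨N + 1, fun n hn => by simp [dField, hN (n - 1) (by omega)]⟩⟩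
  map_add' A B := by ext n v; simp [dField]
  map_smul' c A := by ext n v; simp [dField, smul_comm c]

@[simp] theorem der_apply (A : quantumFields M) (n : ℤ) :
    (der A).1 n = (-n : ℂ) • A.1 (n - 1) := rfl

theorem der_shift (r : ℤ) (A : quantumFields M) :
    der (shift r A) = shift r (der A) + (r : ℂ) • shift (r - 1) A := by
  ext n v
  have h₁ : n - 1 + r = n + (r - 1) := by ring
  have h₂ : n + r - 1 = n + (r - 1) := by ring
  simp only [der_apply, shift_apply, Submodule.coe_add, Submodule.coe_smul, Pi.add_apply,
    Pi.smul_apply, LinearMap.add_apply, LinearMap.smul_apply, h₁, h₂]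
  push_cast
  module

variable (M) in
/-- The identity field, as a quantum field. -/
def oneField : quantumFields M :=
  ⟨idField, fun _ => ⟨0, fun n hn => by
    rw [idField, if_neg (by omega), LinearMap.zero_apply]⟩⟩

theorem oneField_apply (n : ℤ) : (oneField M).1 n = if n = -1 then 1 else 0 := rfl

/-- The super-commutator of an operator with the modes of a field, `η` being the sign of their
exchange. -/
def superComm (η : ℂ) : Module.End ℂ M →ₗ[ℂ] quantumFields M →ₗ[ℂ] quantumFields M :=
  LinearMap.mk₂ ℂ
    (fun T A => ⟨fun n => T * A.1 n - η • (A.1 n * T),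
      isQuantumField_iff_eventually.2 fun v => by
        filter_upwards [eventually_mode_apply_eq_zero A v,
          eventually_mode_apply_eq_zero A (T v)] with n h₁ h₂
        simp [h₁, h₂]⟩)
    (fun T T' A => by ext n v; simp; module)
    (fun c T A => by ext n v; simp; module)
    (fun T A A' => by ext n v; simp; module)
    (fun c T A => by ext n v; simp; module)

theorem superComm_apply (η : ℂ) (T : Module.End ℂ M) (A : quantumFields M) (n : ℤ) :
    (superComm η T A).1 n = T * A.1 n - η • (A.1 n * T) := rfl

/-- The `j`-th summand of the `n`-th mode of the normally ordered product of `A` and `B`, `ε` being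
the sign of their exchange. -/
def normalTerm (ε : ℂ) (A B : FormalDist M) (n : ℤ) (j : ℕ) : Module.End ℂ M :=
  A (-1 - j) * B (n + j) + ε • (B (n - 1 - j) * A j)

theorem normalTerm_apply (ε : ℂ) (A B : FormalDist M) (n : ℤ) (j : ℕ) (v : M) :
    normalTerm ε A B n j v = A (-1 - j) (B (n + j) v) + ε • B (n - 1 - j) (A j v) := rfl

theorem eventually_normalTerm_apply_eq_zero (ε : ℂ) (A B : quantumFields M) (n : ℤ) (v : M) :
    ∀ᶠ j : ℕ in atTop, normalTerm ε A.1 B.1 n j v = 0 := by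
  filter_upwards [eventually_add_mode_apply_eq_zero A 0 v,
    eventually_add_mode_apply_eq_zero B n v] with j hA hB
  rw [zero_add] at hA
  simp [normalTerm_apply, hA, hB]

theorem normalTerm_support_finite (ε : ℂ) (A B : quantumFields M) (n : ℤ) (v : M) :
    (Function.support fun j => normalTerm ε A.1 B.1 n j v).Finite := by
  have h := eventually_normalTerm_apply_eq_zero ε A B n v
  rwa [← Nat.cofinite_eq_atTop, eventually_cofinite] at h

theorem eventually_forall_normalTerm_apply_eq_zero (ε : ℂ) (A B : quantumFields M) (v : M) :
    ∀ᶠ n : ℤ in atTop, ∀ j, normalTerm ε A.1 B.1 n j v = 0 := by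
  obtain ⟨NA, hA⟩ := A.2 v
  obtain ⟨NB, hB⟩ := B.2 v
  have hBA : ∀ᶠ n : ℤ in atTop, ∀ j ∈ Finset.range NA.toNat, B.1 (n - 1 - j) (A.1 j v) = 0 := by
    refine (eventually_all_finset _).2 fun j _ => ?_
    obtain ⟨N, hN⟩ := B.2 (A.1 j v)
    filter_upwards [eventually_ge_atTop (N + 1 + j)] with n hn using hN _ (by omega)
  filter_upwards [eventually_ge_atTop NB, hBA] with n hn hn' j
  rw [normalTerm_apply, hB _ (by omega), map_zero, zero_add]
  by_cases hj : j < NA.toNat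
  · rw [hn' j (Finset.mem_range.2 hj), smul_zero]
  · rw [hA j (by omega), map_zero, smul_zero]

theorem superComm_swap_apply {η : ℂ} (hη : η * η = 1) (A B : quantumFields M) (m n : ℤ) :
    (superComm η (A.1 m) B).1 n = -η • (superComm η (B.1 n) A).1 m := by
  rw [superComm_apply, superComm_apply, smul_sub, smul_smul, neg_mul, hη]
  module

theorem superComm_flip {η : ℂ} (hη : η * η = 1) {A B C : quantumFields M}
    (h : ∀ n, superComm η (B.1 n) A = shift n C) (m : ℤ) :
    superComm η (A.1 m) B = -η • shift m C := by
  ext n v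
  rw [superComm_swap_apply hη, h, shift_apply, add_comm]
  rfl

theorem superComm_flip_der {A B C : quantumFields M}
    (h : ∀ n : ℤ, superComm 1 (B.1 n) A = (n : ℂ) • shift (n - 1) C) (m : ℤ) :
    superComm 1 (A.1 m) B = der (shift m C) := by
  ext n v
  rw [superComm_swap_apply (mul_one 1), h, der_apply, shift_apply,
    show n - 1 + m = m + (n - 1) by ring]
  simp

/-- The normally ordered product of two fields, `ε` being the sign of their exchange. -/
def normalProd (ε : ℂ) : quantumFields M →ₗ[ℂ] quantumFields M →ₗ[ℂ] quantumFields M :=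
  LinearMap.mk₂ ℂ
    (fun A B =>
      ⟨fun n =>
        { toFun v := ∑ᶠ j, normalTerm ε A.1 B.1 n j v
          map_add' v w := by
            simp only [map_add]
            exact finsum_add_distrib (normalTerm_support_finite ε A B n v)
              (normalTerm_support_finite ε A B n w)
          map_smul' c v := by simp only [map_smul, smul_finsum, RingHom.id_apply] },
        isQuantumField_iff_eventually.2 fun v => by
          filter_upwards [eventually_forall_normalTerm_apply_eq_zero ε A B v] with n hn
          exact (finsum_congr hn).trans finsum_zero⟩)
    (fun A A' B => by
      ext n v
      refine (finsum_congr fun j => ?_).trans (finsum_add_distrib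
        (normalTerm_support_finite ε A B n v) (normalTerm_support_finite ε A' B n v))
      simp [normalTerm_apply]; module)
    (fun c A B => by
      ext n v
      refine (finsum_congr fun j => ?_).trans (smul_finsum _ _).symm
      simp [normalTerm_apply]; module)
    (fun A B B' => by
      ext n v
      refine (finsum_congr fun j => ?_).trans (finsum_add_distrib
        (normalTerm_support_finite ε A B n v) (normalTerm_support_finite ε A B' n v))
      simp [normalTerm_apply]; module)
    (fun c A B => by
      ext n v
      refine (finsum_congr fun j => ?_).trans (smul_finsum _ _).symm
      simp [normalTerm_apply]; module)

theorem normalProd_apply (ε : ℂ) (A B : quantumFields M) (n : ℤ) (v : M) :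
    (normalProd ε A B).1 n v = ∑ᶠ j, normalTerm ε A.1 B.1 n j v := rfl

theorem eventually_normalProd_apply_eq_sum (ε : ℂ) (A B : quantumFields M) (n : ℤ) (v : M) :
    ∀ᶠ N : ℕ in atTop,
      (normalProd ε A B).1 n v = ∑ j ∈ Finset.range N, normalTerm ε A.1 B.1 n j v := by
  obtain ⟨N₀, hN₀⟩ := eventually_atTop.1 (eventually_normalTerm_apply_eq_zero ε A B n v)
  filter_upwards [eventually_ge_atTop N₀] with N hN
  refine finsum_eq_sum_of_support_subset _ fun j hj => ?_
  rw [Finset.coe_range, Set.mem_Iio]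
  by_contra hjN
  exact hj (hN₀ j (by omega))

theorem normalOrd_eq_normalProd (p q : ZMod 2) (A B : quantumFields M) (n : ℤ) (v : M) :
    normalOrd p q A.1 B.1 n v = (normalProd (koszul p q) A B).1 n v := by
  refine finsum_congr fun j => ?_
  have hchoose : (Ring.choose (-1 : ℤ) j : ℤ) = (-1) ^ j := by
    rw [Ring.choose_neg', Int.negOnePow_def]
    simp [Units.smul_def]
  have hsign : (-1 : ℂ) ^ j * (((-1 : ℤ) ^ j : ℤ) : ℂ) = 1 := by
    push_cast
    rw [← mul_pow, neg_one_mul, neg_neg, one_pow]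
  have hindex : n + -1 - (j : ℤ) = n - 1 - j := by ring
  rw [hchoose, hsign, one_smul, hindex, normalTerm_apply]
  simp [sub_eq_add_neg]

theorem normalProd_shift_right (ε : ℂ) (r : ℤ) (A B : quantumFields M) :
    normalProd ε A (shift r B) = shift r (normalProd ε A B) := by
  ext n v
  refine finsum_congr fun j => ?_
  simp only [normalTerm_apply, shift_apply]
  rw [add_right_comm, show n - 1 - (j : ℤ) + r = n + r - 1 - j by ring]

theorem normalProd_shift_one_left (ε : ℂ) (A B : quantumFields M) :
    normalProd ε (shift 1 A) B = shift 1 (normalProd ε A B) + superComm ε (A.1 0) B := by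
  ext n v
  let g : ℕ → M := fun j => A.1 (-j) (B.1 (n + j) v) - ε • B.1 (n - j) (A.1 j v)
  have telescope (j : ℕ) : normalTerm ε (shift 1 A).1 B.1 n j v
      - normalTerm ε A.1 B.1 (n + 1) j v = g j - g (j + 1) := by
    simp only [g, normalTerm_apply, shift_apply, Nat.cast_add, Nat.cast_one]
    rw [show -1 - (j : ℤ) + 1 = -j by ring, show -((j : ℤ) + 1) = -1 - j by ring,
      show n + ((j : ℤ) + 1) = n + 1 + j by ring, show n - ((j : ℤ) + 1) = n - 1 - j by ring,
      add_sub_cancel_right]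
    module
  obtain ⟨N, h₁, h₂, hA, hB⟩ :=
    ((eventually_normalProd_apply_eq_sum ε (shift 1 A) B n v).and
      ((eventually_normalProd_apply_eq_sum ε A B (n + 1) v).and
        ((eventually_add_mode_apply_eq_zero A 0 v).and
          (eventually_add_mode_apply_eq_zero B n v)))).exists
  rw [zero_add] at hA
  have hgN : g N = 0 := by simp [g, hA, hB]
  have hg0 : g 0 = (superComm ε (A.1 0) B).1 n v := by simp [g, superComm_apply]
  change _ = (normalProd ε A B).1 (n + 1) v + _
  rw [← sub_eq_iff_eq_add', h₁, h₂, ← Finset.sum_sub_distrib,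
    Finset.sum_congr rfl fun j _ => telescope j, Finset.sum_range_sub', hgN, hg0, sub_zero]

theorem normalProd_shift_add_one_left (ε : ℂ) (r : ℤ) (A B : quantumFields M) :
    normalProd ε (shift (r + 1) A) B
      = shift 1 (normalProd ε (shift r A) B) + superComm ε (A.1 r) B := by
  rw [add_comm r 1, ← shift_shift, normalProd_shift_one_left, shift_apply, zero_add]

theorem eq_of_shift_recurrence {X Y : ℤ → quantumFields M} (h₀ : X 0 = Y 0)
    (h : ∀ r, X (r + 1) - shift 1 (X r) = Y (r + 1) - shift 1 (Y r)) (r : ℤ) : X r = Y r := by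
  induction r using Int.induction_on with
  | zero => exact h₀
  | succ r ih => simpa [ih] using h r
  | pred r ih =>
    have h₁ := h (-r - 1)
    rw [sub_add_cancel, ih, sub_right_inj] at h₁
    simpa [shift_shift] using congrArg (shift (-1)) h₁

/-- `A` and `B` are free fields with contraction `A(z) B(w) ∼ c / (z - w)`, where `ε` is the sign
of their exchange. -/
def HasContraction (ε c : ℂ) (A B : quantumFields M) : Prop :=
  ∀ m, superComm ε (A.1 m) B = c • shift m (oneField M)

theorem hasContraction_zero_iff {ε : ℂ} {A B : quantumFields M} :
    HasContraction ε 0 A B ↔ ∀ m, superComm ε (A.1 m) B = 0 := by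
  simp [HasContraction]

theorem normalProd_shift_left {ε c : ℂ} {A B : quantumFields M} (h : HasContraction ε c A B)
    (r : ℤ) : normalProd ε (shift r A) B
      = shift r (normalProd ε A B) + (r * c) • shift (r - 1) (oneField M) := by
  revert r
  refine eq_of_shift_recurrence (by simp) fun r => ?_
  rw [normalProd_shift_add_one_left, h]
  simp only [map_add, map_smul, shift_shift, add_sub_cancel, add_comm r 1, add_sub_cancel_left]
  push_cast
  module

theorem HasContraction.zero_normalProd_shift_left {ε : ℂ} {A B : quantumFields M}
    (h : HasContraction ε 0 A B) (r : ℤ) :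
    normalProd ε (shift r A) B = shift r (normalProd ε A B) := by
  rw [normalProd_shift_left h, mul_zero, zero_smul, add_zero]

theorem normalProd_der_shift_left {ε c : ℂ} {A B : quantumFields M} (h : HasContraction ε c A B)
    (r : ℤ) : normalProd ε (der (shift r A)) B
      = shift r (normalProd ε (der A) B) + (r : ℂ) • shift (r - 1) (normalProd ε A B)
        + (r * (r - 1) / 2 * c) • shift (r - 2) (oneField M) := by
  have hder (r : ℤ) :
      superComm ε ((der A).1 r) B = (-r * c : ℂ) • shift (r - 1) (oneField M) := by
    rw [der_apply, map_smul, LinearMap.smul_apply, h, smul_smul]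
  have shift_der (r : ℤ) : normalProd ε (shift r (der A)) B = shift r (normalProd ε (der A) B)
      - (r * (r - 1) / 2 * c) • shift (r - 2) (oneField M) := by
    revert r
    refine eq_of_shift_recurrence (by simp) fun r => ?_
    rw [normalProd_shift_add_one_left, hder]
    simp only [map_sub, map_smul, shift_shift, add_comm r 1,
      show 1 + (r - 2) = r - 1 by ring, show 1 + r - 2 = r - 1 by ring]
    push_cast
    module
  rw [der_shift, map_add, map_smul, LinearMap.add_apply, LinearMap.smul_apply, shift_der,
    normalProd_shift_left h, sub_sub, one_add_one_eq_two]
  push_cast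
  module

/-- The `0`-th modes of the two products agree termwise; the `n`-th modes are the `0`-th modes of
products with `w ^ n B(w)`, whose contraction term is a multiple of `n δ_{n,0} = 0`. -/
theorem normalProd_swap {ε c : ℂ} (hε : ε * ε = 1) {A B : quantumFields M}
    (h : HasContraction ε c B A) :
    normalProd ε A B = ε • normalProd ε B A := by
  have swap_zero (C : quantumFields M) (v : M) :
      (normalProd ε A C).1 0 v = ε • (normalProd ε C A).1 0 v := by
    rw [normalProd_apply, normalProd_apply, smul_finsum]
    refine finsum_congr fun j => ?_
    rw [normalTerm_apply, normalTerm_apply, smul_add, smul_smul, hε, one_smul, zero_add, zero_sub,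
      add_comm]
  ext n v
  have hcontraction : ((n * c) • shift (n - 1) (oneField M)).1 0 = 0 := by
    rcases eq_or_ne n 0 with rfl | hn
    · simp
    · simp [oneField_apply, hn]
  calc (normalProd ε A B).1 n v = (normalProd ε A (shift n B)).1 0 v := by
        rw [normalProd_shift_right, shift_apply, zero_add]
    _ = ε • (normalProd ε (shift n B) A).1 0 v := swap_zero _ v
    _ = ε • (normalProd ε B A).1 n v := by
        rw [normalProd_shift_left h, Submodule.coe_add, Pi.add_apply, hcontraction, add_zero,
          shift_apply, zero_add]

theorem der_normalProd (ε : ℂ) (A B : quantumFields M) :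
    der (normalProd ε A B) = normalProd ε (der A) B + normalProd ε A (der B) := by
  ext n v
  let g : ℕ → M := fun j =>
    (j : ℂ) • (A.1 (-1 - j) (B.1 (n - 1 + j) v) + ε • B.1 (n - 1 - j) (A.1 (-1 + j) v))
  have telescope (j : ℕ) : (-n : ℂ) • normalTerm ε A.1 B.1 (n - 1) j v
      - (normalTerm ε (der A).1 B.1 n j v + normalTerm ε A.1 (der B).1 n j v)
        = g j - g (j + 1) := by
    simp only [g, normalTerm_apply, der_apply, LinearMap.smul_apply, map_smul]
    push_cast
    rw [show -1 - (j : ℤ) - 1 = -1 - (j + 1) by ring, show n + (j : ℤ) - 1 = n - 1 + j by ring,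
      show n - 1 + ((j : ℤ) + 1) = n + j by ring,
      show n - 1 - 1 - (j : ℤ) = n - 1 - (j + 1) by ring,
      show n - 1 - (j : ℤ) - 1 = n - 1 - (j + 1) by ring, show -1 + ((j : ℤ) + 1) = j by ring,
      show (j : ℤ) - 1 = -1 + j by ring]
    module
  obtain ⟨N, h₁, h₂, h₃, hA, hB⟩ :=
    ((eventually_normalProd_apply_eq_sum ε A B (n - 1) v).and
      ((eventually_normalProd_apply_eq_sum ε (der A) B n v).and
        ((eventually_normalProd_apply_eq_sum ε A (der B) n v).and
          ((eventually_add_mode_apply_eq_zero A (-1) v).and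
            (eventually_add_mode_apply_eq_zero B (n - 1) v))))).exists
  have hgN : g N = 0 := by simp [g, hA, hB]
  have hg0 : g 0 = 0 := by simp [g]
  change (-n : ℂ) • (normalProd ε A B).1 (n - 1) v
    = (normalProd ε (der A) B).1 n v + (normalProd ε A (der B)).1 n v
  rw [← sub_eq_zero, h₁, h₂, h₃, ← Finset.sum_add_distrib, Finset.smul_sum,
    ← Finset.sum_sub_distrib, Finset.sum_congr rfl fun j _ => telescope j, Finset.sum_range_sub',
    hgN, hg0, sub_zero]

theorem superComm_mul_normalProd {η : ℂ} (hη : η * η = 1) (η' ε : ℂ) (T : Module.End ℂ M)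
    (A B : quantumFields M) :
    superComm (η * η') T (normalProd ε A B)
      = normalProd (ε * η') (superComm η T A) B + η • normalProd (ε * η) A (superComm η' T B) := by
  ext n v
  obtain ⟨N, h₁, h₂, h₃, h₄⟩ :=
    ((eventually_normalProd_apply_eq_sum ε A B n v).and
      ((eventually_normalProd_apply_eq_sum ε A B n (T v)).and
        ((eventually_normalProd_apply_eq_sum (ε * η') (superComm η T A) B n v).and
          (eventually_normalProd_apply_eq_sum (ε * η) A (superComm η' T B) n v)))).exists
  change T ((normalProd ε A B).1 n v) - (η * η') • (normalProd ε A B).1 n (T v)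
    = (normalProd (ε * η') (superComm η T A) B).1 n v
      + η • (normalProd (ε * η) A (superComm η' T B)).1 n v
  rw [h₁, h₂, h₃, h₄, map_sum, Finset.smul_sum, Finset.smul_sum, ← Finset.sum_sub_distrib,
    ← Finset.sum_add_distrib]
  refine Finset.sum_congr rfl fun j _ => ?_
  simp only [normalTerm_apply, superComm_apply, LinearMap.sub_apply, Module.End.mul_apply,
    LinearMap.smul_apply, map_add, map_sub, map_smul, smul_sub, smul_add, smul_smul]
  rw [show η * (ε * η) = ε by linear_combination ε * hη,
    show η * (ε * η * η') = ε * η' by linear_combination ε * η' * hη]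
  module

theorem superComm_even_normalProd (ε : ℂ) (T : Module.End ℂ M) (A B : quantumFields M) :
    superComm 1 T (normalProd ε A B)
      = normalProd ε (superComm 1 T A) B + normalProd ε A (superComm 1 T B) := by
  simpa using superComm_mul_normalProd (one_mul 1) 1 ε T A B

theorem superComm_odd_normalProd_even_odd (T : Module.End ℂ M) (A B : quantumFields M) :
    superComm (-1) T (normalProd 1 A B)
      = normalProd (-1) (superComm 1 T A) B + normalProd 1 A (superComm (-1) T B) := by
  simpa using superComm_mul_normalProd (one_mul 1) (-1) 1 T A B

theorem superComm_odd_normalProd_odd_odd (T : Module.End ℂ M) (A B : quantumFields M) :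
    superComm 1 T (normalProd (-1) A B)
      = normalProd 1 (superComm (-1) T A) B - normalProd 1 A (superComm (-1) T B) := by
  have h := superComm_mul_normalProd (η := -1) (by norm_num) (-1) (-1) T A B
  rw [neg_mul_neg, one_mul] at h
  rw [h]
  module

theorem normalProd_oneField_left (B : quantumFields M) : normalProd 1 (oneField M) B = B := by
  ext n v
  rw [normalProd_apply, finsum_eq_single _ 0]
  · simp [normalTerm, oneField_apply]
  · intro j hj
    rw [normalTerm_apply, oneField_apply, oneField_apply, if_neg (by omega), if_neg (by omega)]
    simp

theorem superComm_oneField_apply (m : ℤ) (B : quantumFields M) :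
    superComm 1 ((oneField M).1 m) B = 0 := by
  ext n v
  rw [superComm_apply, oneField_apply]
  split_ifs <;> simp

theorem normalProd_shift_oneField_left (r : ℤ) (B : quantumFields M) :
    normalProd 1 (shift r (oneField M)) B = shift r B := by
  rw [(hasContraction_zero_iff.2 fun m => superComm_oneField_apply m B).zero_normalProd_shift_left,
    normalProd_oneField_left]

theorem normalProd_shift_oneField_right (r : ℤ) (A : quantumFields M) :
    normalProd 1 A (shift r (oneField M)) = shift r A := by
  rw [normalProd_shift_right, normalProd_swap (mul_one 1)
    (hasContraction_zero_iff.2 fun m => superComm_oneField_apply m A), one_smul,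
    normalProd_oneField_left]

end FieldCalculus

/-! ### Operator product expansions of the `N = 2` algebra -/

section OPE

variable {M : Type*} [AddCommGroup M] [Module ℂ M] {p q : ZMod 2} {A B : FormalDist M}

@[simp] theorem koszul_zero_left (q : ZMod 2) : koszul 0 q = 1 := by simp [koszul]

@[simp] theorem koszul_zero_right (p : ZMod 2) : koszul p 0 = 1 := by simp [koszul]

@[simp] theorem koszul_one_one : koszul 1 1 = -1 := by simp [koszul]

theorem cast_choose_two (m : ℤ) :
    ((Ring.choose m 2 : ℤ) : ℂ) = (m : ℂ) * (m - 1) / 2 := by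
  have h := congrArg (Int.cast : ℤ → ℂ) (Ring.descPochhammer_eq_factorial_smul_choose m 2)
  simp [descPochhammer_succ_right, Polynomial.smeval_mul, Polynomial.smeval_sub,
    Polynomial.smeval_X] at h
  linear_combination -h / 2

theorem cast_choose_three (m : ℤ) :
    ((Ring.choose m 3 : ℤ) : ℂ) = (m : ℂ) * (m - 1) * (m - 2) / 6 := by
  have h := congrArg (Int.cast : ℤ → ℂ) (Ring.descPochhammer_eq_factorial_smul_choose m 3)
  have htwo : (2 : Polynomial ℤ).smeval m = 2 := by simpa using Polynomial.smeval_natCast ℤ m 2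
  simp [descPochhammer_succ_right, Polynomial.smeval_mul, Polynomial.smeval_sub,
    Polynomial.smeval_X, Nat.factorial, htwo] at h
  linear_combination -h / 6

theorem hasOPE_nil_iff :
    HasOPE p q A B [] ↔ ∀ m n, A m * B n - koszul p q • (B n * A m) = 0 := by
  simp [HasOPE]

theorem hasOPE_singleton_iff {C₀ : FormalDist M} :
    HasOPE p q A B [C₀] ↔ ∀ m n, A m * B n - koszul p q • (B n * A m) = C₀ (m + n) := by
  simp [HasOPE]

theorem hasOPE_pair_iff {C₀ C₁ : FormalDist M} :
    HasOPE p q A B [C₀, C₁] ↔ ∀ m n, A m * B n - koszul p q • (B n * A m)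
      = C₀ (m + n) + (m : ℂ) • C₁ (m + n - 1) := by
  simp [HasOPE]

theorem hasOPE_triple_iff {C₀ C₁ C₂ : FormalDist M} :
    HasOPE p q A B [C₀, C₁, C₂] ↔ ∀ m n, A m * B n - koszul p q • (B n * A m)
      = C₀ (m + n) + (m : ℂ) • C₁ (m + n - 1) + ((m : ℂ) * (m - 1) / 2) • C₂ (m + n - 2) := by
  simp [HasOPE, Fin.sum_univ_succ, cast_choose_two, add_assoc]

theorem hasOPE_quadruple_iff {C₀ C₁ C₂ C₃ : FormalDist M} :
    HasOPE p q A B [C₀, C₁, C₂, C₃] ↔ ∀ m n, A m * B n - koszul p q • (B n * A m)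
      = C₀ (m + n) + (m : ℂ) • C₁ (m + n - 1) + ((m : ℂ) * (m - 1) / 2) • C₂ (m + n - 2)
        + ((m : ℂ) * (m - 1) * (m - 2) / 6) • C₃ (m + n - 3) := by
  simp [HasOPE, Fin.sum_univ_succ, cast_choose_two, cast_choose_three, add_assoc]

end OPE

/-! ### The `N = 2` algebra from a current and a supercurrent -/

section SuperJacobi

variable {E : Type*} [Ring E]

theorem comm_anticomm_eq (x y z : E) :
    x * (y * z + z * y) - (y * z + z * y) * x
      = ((x * y - y * x) * z + z * (x * y - y * x))
        + (y * (x * z - z * x) + (x * z - z * x) * y) := by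
  noncomm_ring

theorem comm_anticomm_eq_zero_of_sq_eq_zero {x : E} (h : x * x = 0) (y : E) :
    (x * y + y * x) * x - x * (x * y + y * x) = 0 := by
  calc (x * y + y * x) * x - x * (x * y + y * x) = y * (x * x) - (x * x) * y := by noncomm_ring
    _ = 0 := by rw [h, mul_zero, zero_mul, sub_zero]

theorem anticomm_comm_eq (x y z : E) :
    (x * y + y * x) * z - z * (x * y + y * x)
      = (x * (y * z + z * y) - (y * z + z * y) * x)
        + (y * (x * z + z * x) - (x * z + z * x) * y) := by
  noncomm_ring

end SuperJacobi

theorem superComm_half_anticomm {M : Type*} [AddCommGroup M] [Module ℂ M] {K X Y : quantumFields M}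
    (hX : ∀ m, superComm (-1) (K.1 m) X = shift m Y)
    (hY : ∀ m, superComm 1 (K.1 m) Y = der (shift m X)) (p : ℤ) :
    superComm 1 (((1 / 2 : ℂ) • superComm (-1) (K.1 0) K).1 p) X
      = der (shift p X) - (p / 2 : ℂ) • shift (p - 1) X := by
  have mode {η : ℂ} {T : Module.End ℂ M} {A C : quantumFields M} (h : superComm η T A = C)
      (n : ℤ) : T * A.1 n - η • (A.1 n * T) = C.1 n := by rw [← h, superComm_apply]
  have X_mode (m n : ℤ) := mode (hX m) n
  have Y_mode (m n : ℤ) := mode (hY m) n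
  simp only [neg_one_smul, sub_neg_eq_add, one_smul, shift_apply, der_apply] at X_mode Y_mode
  ext n v
  have jacobi := anticomm_comm_eq (K.1 0) (K.1 p) (X.1 n)
  rw [X_mode, X_mode, Y_mode, Y_mode, show n + p - 1 + 0 = n - 1 + p by ring, add_zero] at jacobi
  have half_mode : ((1 / 2 : ℂ) • superComm (-1) (K.1 0) K).1 p
      = (1 / 2 : ℂ) • (K.1 0 * K.1 p + K.1 p * K.1 0) := by
    simp [superComm_apply]
  rw [superComm_apply, one_smul, half_mode, smul_mul_assoc, mul_smul_comm, ← smul_sub, jacobi]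
  simp only [Submodule.coe_sub, Submodule.coe_smul, Pi.sub_apply, Pi.smul_apply, der_apply,
    shift_apply, LinearMap.smul_apply, LinearMap.sub_apply, LinearMap.add_apply,
    show n + (p - 1) = n - 1 + p by ring]
  push_cast
  module

section N2Seed

variable {M : Type*} [AddCommGroup M] [Module ℂ M]

theorem idField_mul_comm (n : ℤ) (T : Module.End ℂ M) :
    idField (M := M) n * T = T * idField (M := M) n := by
  unfold idField
  split_ifs
  · rfl
  · rw [zero_mul, mul_zero]

theorem smul_idField_congr {f g : ℂ} {n : ℤ} (h : n = -1 → f = g) :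
    f • idField (M := M) n = g • idField n := by
  by_cases hn : n = -1
  · rw [h hn]
  · simp [idField, hn]

/-- Mode relations between a `U(1)` current `J`, a supercurrent `K`, its companion `H` and the
Virasoro modes `S` from which the whole `N = 2` algebra of central charge `3 k` follows. -/
structure N2Seed (k : ℂ) (J K H S : FormalDist M) : Prop where
  JJ : ∀ m n, J m * J n - J n * J m = (k * m) • idField (m + n - 1)
  JK : ∀ m n, J m * K n - K n * J m = -H (m + n)
  JH : ∀ m n, J m * H n - H n * J m = -K (m + n)
  KK : ∀ m n, K m * K n + K n * K m
    = (2 : ℂ) • S (m + n) + (k * m * (m - 1)) • idField (m + n - 2)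
  SJ : ∀ m n, S m * J n - J n * S m = (-n : ℂ) • J (m + n - 1)

/-- The combination `G⁺ = ½ (K - H)`, which has charge `1` under `J` when `K` and `H` form a
seed; its partner `G⁻ = ½ (K + H)` is `chiral K (-H)`. -/
def chiral (K H : FormalDist M) : FormalDist M := (1 / 2 : ℂ) • (K - H)

theorem chiral_apply (K H : FormalDist M) (n : ℤ) :
    chiral K H n = (1 / 2 : ℂ) • (K n - H n) := rfl

/-- The generators of the `N = 2` algebra attached to a seed. -/
def n2Data (J K H S : FormalDist M) : N2Data M where
  L := S
  J := J
  Gp := chiral K H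
  Gm := chiral K (-H)

namespace N2Seed

variable {k : ℂ} {J K H S : FormalDist M}

theorem neg (h : N2Seed k J K H S) : N2Seed k (-J) K (-H) S where
  JJ m n := by simpa using h.JJ m n
  JK m n := by
    simp only [Pi.neg_apply, neg_mul, mul_neg]
    linear_combination (norm := module) -h.JK m n
  JH m n := by simpa using h.JH m n
  KK := h.KK
  SJ m n := by
    simp only [Pi.neg_apply, neg_mul, mul_neg]
    linear_combination (norm := module) -h.SJ m n

theorem KH (h : N2Seed k J K H S) (a b : ℤ) :
    K a * H b + H b * K a = ((a : ℂ) - b) • J (a + b - 1) := by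
  have jacobi := comm_anticomm_eq (J (b - a)) (K a) (K a)
  have hJK := h.JK (b - a) a
  have hSJ := h.SJ (a + a) (b - a)
  rw [sub_add_cancel] at hJK
  rw [show a + a + (b - a) - 1 = a + b - 1 by ring] at hSJ
  rw [hJK, h.KK] at jacobi
  simp only [add_mul, mul_add, smul_mul_assoc, mul_smul_comm, mul_neg, neg_mul,
    idField_mul_comm (a + a - 2) (J (b - a))] at jacobi
  push_cast at hSJ
  linear_combination (norm := module) (1 / 2 : ℂ) • jacobi + hSJ

theorem HH (h : N2Seed k J K H S) (m n : ℤ) :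
    H m * H n + H n * H m
      = (-2 : ℂ) • S (m + n) - (k * m * (m - 1)) • idField (m + n - 2) := by
  have jacobi := comm_anticomm_eq (J 0) (K m) (H n)
  rw [h.JK, h.JH, h.KH, zero_add, zero_add, mul_smul_comm, smul_mul_assoc, ← smul_sub,
    h.JJ] at jacobi
  simp only [neg_mul, mul_neg] at jacobi
  push_cast at jacobi
  linear_combination (norm := module) jacobi - h.KK m n

theorem anticomm_chiral_chiral (h : N2Seed k J K H S) (m n : ℤ) :
    chiral K H m * chiral K H n + chiral K H n * chiral K H m = 0 := by
  have hKH := h.KH n m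
  rw [add_comm n m] at hKH
  simp only [chiral_apply, smul_mul_assoc, mul_smul_comm, mul_sub, sub_mul]
  linear_combination (norm := module) (1 / 4 : ℂ) • (h.KK m n + h.HH m n - h.KH m n - hKH)

theorem anticomm_chiral_chiral_neg (h : N2Seed k J K H S) (m n : ℤ) :
    chiral K H m * chiral K (-H) n + chiral K (-H) n * chiral K H m
      = S (m + n) + (((m : ℂ) - n) / 2) • J (m + n - 1)
        + (k * m * (m - 1) / 2) • idField (m + n - 2) := by
  have hKH := h.KH n m
  rw [add_comm n m] at hKH
  simp only [chiral_apply, Pi.neg_apply, smul_mul_assoc, mul_smul_comm, mul_sub, sub_mul, mul_neg,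
    neg_mul]
  linear_combination (norm := module) (1 / 4 : ℂ) • (h.KK m n - h.HH m n + h.KH m n - hKH)

theorem comm_J_chiral (h : N2Seed k J K H S) (m n : ℤ) :
    J m * chiral K H n - chiral K H n * J m = chiral K H (m + n) := by
  simp only [chiral_apply, smul_mul_assoc, mul_smul_comm, mul_sub, sub_mul]
  linear_combination (norm := module) (1 / 2 : ℂ) • (h.JK m n - h.JH m n)

theorem comm_S_chiral (h : N2Seed k J K H S) (m n : ℤ) :
    S m * chiral K H n - chiral K H n * S m
      = ((m : ℂ) / 2 - n) • chiral K H (m + n - 1) := by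
  have sq : chiral K H n * chiral K H n = 0 := by
    have hsq := h.anticomm_chiral_chiral n n
    rw [← two_smul ℂ] at hsq
    exact (smul_eq_zero.1 hsq).resolve_left two_ne_zero
  have jacobi := comm_anticomm_eq_zero_of_sq_eq_zero sq (chiral K (-H) (m - n))
  have hJ := h.comm_J_chiral (m - 1) n
  rw [show m - 1 + n = m + n - 1 by ring] at hJ
  rw [h.anticomm_chiral_chiral_neg, show n + (m - n) = m by ring] at jacobi
  simp only [add_mul, mul_add, smul_mul_assoc, mul_smul_comm,
    idField_mul_comm (m - 2) (chiral K H n)] at jacobi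
  push_cast at jacobi
  linear_combination (norm := module) jacobi - ((2 * (n : ℂ) - m) / 2) • hJ

theorem comm_S_S (h : N2Seed k J K H S) (m n : ℤ) :
    S m * S n - S n * S m = ((m : ℂ) - n) • S (m + n - 1)
      + (k * m * (m - 1) * (m - 2) / 4) • idField (m + n - 3) := by
  have jacobi := comm_anticomm_eq (S m) (chiral K H n) (chiral K (-H) 0)
  rw [h.comm_S_chiral, h.neg.comm_S_chiral] at jacobi
  simp only [smul_mul_assoc, mul_smul_comm, ← smul_add, h.anticomm_chiral_chiral_neg] at jacobi
  have hSJ := h.SJ m (n - 1)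
  simp only [add_mul, mul_add, smul_mul_assoc, mul_smul_comm, idField_mul_comm (n - 2) (S m),
    add_zero, show m + n - 1 - 1 = m + n - 2 by ring, show m + n - 1 - 2 = m + n - 3 by ring,
    show m + (n - 1) - 1 = m + n - 2 by ring, show n + (m - 1) = m + n - 1 by ring] at jacobi hSJ
  have central : (((m : ℂ) / 2 - n) * (k * (m + n - 1) * (m + n - 2) / 2)
      + ((m : ℂ) / 2) * (k * n * (n - 1) / 2)) • idField (M := M) (m + n - 3)
      = (k * m * (m - 1) * (m - 2) / 4) • idField (m + n - 3) := by
    refine smul_idField_congr fun hmn => ?_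
    obtain rfl : n = 2 - m := by omega
    push_cast
    ring
  push_cast at jacobi hSJ
  linear_combination (norm := module) jacobi - ((n : ℂ) / 2) • hSJ + central

theorem hasOPE_S_chiral (h : N2Seed k J K H S) :
    HasOPE 0 1 S (chiral K H) [dField (chiral K H), (3 / 2 : ℂ) • chiral K H] :=
  hasOPE_pair_iff.2 fun m n => by
    rw [koszul_zero_left, one_smul, h.comm_S_chiral, dField, Pi.smul_apply]
    push_cast
    module

theorem hasOPE_chiral_chiral (h : N2Seed k J K H S) :
    HasOPE 1 1 (chiral K H) (chiral K H) [] :=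
  hasOPE_nil_iff.2 fun m n => by
    rw [koszul_one_one, neg_one_smul, sub_neg_eq_add, h.anticomm_chiral_chiral]

end N2Seed

/-- The space of quantum fields of parity `p` for the grading `S`. -/
def parityFields (S : ZMod 2 → Submodule ℂ M) (p : ZMod 2) : Submodule ℂ (quantumFields M) where
  carrier := {A | HasParity S p A.1}
  add_mem' hA hB n q v hv := add_mem (hA n q v hv) (hB n q v hv)
  zero_mem' _ _ _ _ := zero_mem _
  smul_mem' c _ hA n q v hv := Submodule.smul_mem _ c (hA n q v hv)

theorem N2Seed.isN2 {k : ℂ} {J K H S : quantumFields M} (h : N2Seed k J.1 K.1 H.1 S.1)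
    (P : ZMod 2 → Submodule ℂ M) (hS : S ∈ parityFields P 0) (hJ : J ∈ parityFields P 0)
    (hK : K ∈ parityFields P 1) (hH : H ∈ parityFields P 1) :
    IsN2 P (3 * k) (n2Data J.1 K.1 H.1 S.1) where
  field_L := S.2
  field_J := J.2
  field_Gp := ((1 / 2 : ℂ) • (K - H)).2
  field_Gm := ((1 / 2 : ℂ) • (K - -H)).2
  parity_L := hS
  parity_J := hJ
  parity_Gp := Submodule.smul_mem _ _ (sub_mem hK hH)
  parity_Gm := Submodule.smul_mem _ _ (sub_mem hK (neg_mem hH))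
  LL := hasOPE_quadruple_iff.2 fun m n => by
    simp only [n2Data, koszul_zero_left, one_smul, h.comm_S_S, dField, Pi.smul_apply,
      Pi.zero_apply]
    push_cast
    module
  LJ := hasOPE_pair_iff.2 fun m n => by
    simp only [n2Data, koszul_zero_left, one_smul, h.SJ, dField]
    push_cast
    module
  LGp := h.hasOPE_S_chiral
  LGm := h.neg.hasOPE_S_chiral
  JJ := hasOPE_pair_iff.2 fun m n => by
    simp only [n2Data, koszul_zero_left, one_smul, h.JJ, Pi.smul_apply, Pi.zero_apply]
    module
  JGp := hasOPE_singleton_iff.2 fun m n => by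
    rw [koszul_zero_left, one_smul]
    exact h.comm_J_chiral m n
  JGm := hasOPE_singleton_iff.2 fun m n => by
    have hG := h.neg.comm_J_chiral m n
    simp only [Pi.neg_apply, neg_mul, mul_neg] at hG
    simp only [n2Data, koszul_zero_left, one_smul, Pi.neg_apply]
    linear_combination (norm := module) -hG
  GpGm := hasOPE_triple_iff.2 fun m n => by
    simp only [n2Data, koszul_one_one, neg_one_smul, sub_neg_eq_add, h.anticomm_chiral_chiral_neg,
      dField, Pi.add_apply, Pi.smul_apply]
    push_cast
    module
  GpGp := h.hasOPE_chiral_chiral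
  GmGm := h.neg.hasOPE_chiral_chiral

end N2Seed

/-! ### The seed attached to a central Lagrangian frame -/

section Construction

variable {M : Type*} [AddCommGroup M] [Module ℂ M]

section Fields

variable {𝔡 : Type*} [AddCommGroup 𝔡] [Module ℂ 𝔡] {ι : Type*} [Fintype ι]

/-- The bilinear combinations `∑ cᵢⱼ :w̄ᵢ w̄ⱼ:` of the odd currents of `w`. -/
def fermionBilinear (bar : 𝔡 →ₗ[ℂ] quantumFields M) (w : ι → 𝔡) :
    (ι → ι → ℂ) →ₗ[ℂ] quantumFields M where
  toFun c := ∑ i, ∑ j, c i j • normalProd (-1) (bar (w i)) (bar (w j))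
  map_add' c c' := by simp only [Pi.add_apply, add_smul, Finset.sum_add_distrib]
  map_smul' r c := by
    simp only [Pi.smul_apply, smul_eq_mul, mul_smul, Finset.smul_sum, RingHom.id_apply]

theorem fermionBilinear_apply (bar : 𝔡 →ₗ[ℂ] quantumFields M) (w : ι → 𝔡) (c : ι → ι → ℂ) :
    fermionBilinear bar w c = ∑ i, ∑ j, c i j • normalProd (-1) (bar (w i)) (bar (w j)) := rfl

/-- The `U(1)` current of the frame. -/
def jField (bar : 𝔡 →ₗ[ℂ] quantumFields M) (σ : ι → ℂ) (w d : ι → 𝔡) : quantumFields M :=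
  ∑ k, σ k • normalProd (-1) (bar (d k)) (bar (w k))

/-- The difference `G⁻ - G⁺` of the two supercurrents of the frame. -/
def hField (cur bar : 𝔡 →ₗ[ℂ] quantumFields M) (σ : ι → ℂ) (w d : ι → 𝔡) : quantumFields M :=
  ∑ k, σ k • (normalProd 1 (cur (d k)) (bar (w k)) - normalProd 1 (cur (w k)) (bar (d k)))

/-- The field by which the `U(1)` current moves the even current of `d l`. -/
def qField (bar : 𝔡 →ₗ[ℂ] quantumFields M) (σ : ι → ℂ) (F : ι → ι → ι → ℂ) (w : ι → 𝔡) (l : ι) :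
    quantumFields M :=
  fermionBilinear bar w fun i j => σ j * F l i j

/-- The sum `G⁺ + G⁻` of the two supercurrents, which is the Kac–Todorov supercurrent of `𝔡`: by
the charge condition, `-∑ σ k q k w̄ k` is its cubic term. -/
def kField (cur bar : 𝔡 →ₗ[ℂ] quantumFields M) (σ : ι → ℂ) (F : ι → ι → ι → ℂ) (w d : ι → 𝔡) :
    quantumFields M :=
  ∑ k, (normalProd 1 (cur (d k)) (bar (w k)) + normalProd 1 (cur (w k)) (bar (d k))
    - σ k • normalProd 1 (qField bar σ F w k) (bar (w k)))

/-- The Virasoro field of the frame, half the simple pole of `K(z) K(w)`. -/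
def sField (cur bar : 𝔡 →ₗ[ℂ] quantumFields M) (σ : ι → ℂ) (F : ι → ι → ι → ℂ) (w d : ι → 𝔡) :
    quantumFields M :=
  (1 / 2 : ℂ) • superComm (-1) ((kField cur bar σ F w d).1 0) (kField cur bar σ F w d)

end Fields

variable {𝔡 : Type*} [LieRing 𝔡] [LieAlgebra ℂ 𝔡]

/-- Even currents `cur a` and odd currents `bar a` of the level-one super-affinization of a Lie
algebra with a bilinear form `B`, acting on `M`. -/
structure CurrentSystem (B : LinearMap.BilinForm ℂ 𝔡) (cur bar : 𝔡 →ₗ[ℂ] quantumFields M) :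
    Prop where
  cur_cur : ∀ (a b : 𝔡) (n : ℤ), superComm 1 ((cur a).1 n) (cur b)
    = shift n (cur ⁅a, b⁆) + (n * B a b) • shift (n - 1) (oneField M)
  cur_bar : ∀ (a b : 𝔡) (n : ℤ), superComm 1 ((cur a).1 n) (bar b) = shift n (bar ⁅a, b⁆)
  bar_cur : ∀ (a b : 𝔡) (n : ℤ), superComm 1 ((bar a).1 n) (cur b) = shift n (bar ⁅a, b⁆)
  bar_bar : ∀ a b : 𝔡, HasContraction (-1) (B a b) (bar a) (bar b)

variable {ι : Type*} [Fintype ι] [DecidableEq ι]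

/-- Dual bases `w` and `d` of two transversal Lagrangian subspaces, the first of which is central
and contains the brackets of the second, with structure constants `F`. The signs `σ k = ±1` are the
charges of the `d k`; `charge` says that `σ i`, `σ j`, `σ k` are not all equal if `F i j k ≠ 0`. -/
structure AdaptedFrame (B : LinearMap.BilinForm ℂ 𝔡) (σ : ι → ℂ) (F : ι → ι → ι → ℂ)
    (w d : ι → 𝔡) : Prop where
  w_lie : ∀ (i : ι) (x : 𝔡), ⁅w i, x⁆ = 0
  d_lie_d : ∀ i j, ⁅d i, d j⁆ = ∑ k, F i j k • w k
  ww : ∀ i j, B (w i) (w j) = 0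
  dd : ∀ i j, B (d i) (d j) = 0
  wd : ∀ i j, B (w i) (d j) = if i = j then 1 else 0
  dw : ∀ i j, B (d i) (w j) = if i = j then 1 else 0
  swap_left : ∀ i j k, F i j k = -F j i k
  swap_right : ∀ i j k, F i j k = -F i k j
  sq : ∀ i, σ i * σ i = 1
  charge : ∀ i j k, F i j k * (1 + σ i * σ j + σ j * σ k + σ k * σ i) = 0

namespace AdaptedFrame

variable {B : LinearMap.BilinForm ℂ 𝔡} {σ : ι → ℂ} {F : ι → ι → ι → ℂ} {w d : ι → 𝔡}

theorem lie_w (hb : AdaptedFrame B σ F w d) (x : 𝔡) (i : ι) : ⁅x, w i⁆ = 0 := by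
  rw [← lie_skew, hb.w_lie, neg_zero]

theorem cyclic (hb : AdaptedFrame B σ F w d) (i j k : ι) : F i j k = F k i j := by
  rw [hb.swap_right, hb.swap_left, neg_neg]

end AdaptedFrame

namespace CurrentSystem

variable {B : LinearMap.BilinForm ℂ 𝔡} {cur bar : 𝔡 →ₗ[ℂ] quantumFields M}
  {σ : ι → ℂ} {F : ι → ι → ι → ℂ} {w d : ι → 𝔡}

theorem hasContraction_barw_barw (hc : CurrentSystem B cur bar) (hb : AdaptedFrame B σ F w d)
    (i j : ι) : HasContraction (-1) 0 (bar (w i)) (bar (w j)) :=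
  hb.ww i j ▸ hc.bar_bar _ _

theorem hasContraction_barw_bard (hc : CurrentSystem B cur bar) (hb : AdaptedFrame B σ F w d)
    (i : ι) : HasContraction (-1) 1 (bar (w i)) (bar (d i)) := by
  simpa [hb.wd] using hc.bar_bar (w i) (d i)

theorem hasContraction_bard_barw (hc : CurrentSystem B cur bar) (hb : AdaptedFrame B σ F w d)
    (i : ι) : HasContraction (-1) 1 (bar (d i)) (bar (w i)) := by
  simpa [hb.dw] using hc.bar_bar (d i) (w i)

theorem hasContraction_curw_bar (hc : CurrentSystem B cur bar) (hb : AdaptedFrame B σ F w d)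
    (i : ι) (x : 𝔡) : HasContraction 1 0 (cur (w i)) (bar x) :=
  hasContraction_zero_iff.2 fun n => by rw [hc.cur_bar, hb.w_lie, map_zero, map_zero]

theorem superComm_bar_bar (hc : CurrentSystem B cur bar) (x y : 𝔡) (n : ℤ) :
    superComm (-1) ((bar x).1 n) (bar y) = B x y • shift n (oneField M) :=
  hc.bar_bar x y n

theorem fermionBilinear_transpose (hc : CurrentSystem B cur bar) (hb : AdaptedFrame B σ F w d)
    (c : ι → ι → ℂ) : (fermionBilinear bar w fun i j => c j i) = -fermionBilinear bar w c := by
  simp only [fermionBilinear_apply, ← Finset.sum_neg_distrib]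
  rw [Finset.sum_comm]
  refine Finset.sum_congr rfl fun i _ => Finset.sum_congr rfl fun j _ => ?_
  rw [normalProd_swap (by norm_num) (hc.hasContraction_barw_barw hb i j)]
  module

theorem fermionBilinear_congr (hc : CurrentSystem B cur bar) (hb : AdaptedFrame B σ F w d)
    {c c' : ι → ι → ℂ} (h : ∀ i j, c i j - c j i = c' i j - c' j i) :
    fermionBilinear bar w c = fermionBilinear bar w c' := by
  have hcc : (c - fun i j => c j i) = c' - fun i j => c' j i := funext₂ h
  have h₂ := congrArg (fermionBilinear bar w) hcc
  rw [map_sub, map_sub, hc.fermionBilinear_transpose hb c, hc.fermionBilinear_transpose hb c'] at h₂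
  linear_combination (norm := module) (1 / 2 : ℂ) • h₂

theorem barw_fermionBilinear (hc : CurrentSystem B cur bar) (hb : AdaptedFrame B σ F w d)
    (l : ι) (n : ℤ) (c : ι → ι → ℂ) :
    superComm 1 ((bar (w l)).1 n) (fermionBilinear bar w c) = 0 := by
  simp [fermionBilinear_apply, superComm_odd_normalProd_odd_odd, hc.superComm_bar_bar, hb.ww]

theorem bard_fermionBilinear (hc : CurrentSystem B cur bar) (hb : AdaptedFrame B σ F w d)
    (l : ι) (n : ℤ) (c : ι → ι → ℂ) :
    superComm 1 ((bar (d l)).1 n) (fermionBilinear bar w c)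
      = shift n (∑ j, (c l j - c j l) • bar (w j)) := by
  simp only [fermionBilinear_apply, map_sum, map_smul, superComm_odd_normalProd_odd_odd,
    hc.superComm_bar_bar, hb.dw, LinearMap.smul_apply, normalProd_shift_oneField_left,
    normalProd_shift_oneField_right, smul_sub, Finset.sum_sub_distrib]
  rw [Finset.sum_comm]
  simp only [ite_smul, one_smul, zero_smul, smul_ite, smul_zero, Finset.sum_ite_eq,
    Finset.mem_univ, if_true, ← Finset.sum_sub_distrib]
  exact Finset.sum_congr rfl fun j _ => by module

theorem cur_fermionBilinear (hc : CurrentSystem B cur bar) (hb : AdaptedFrame B σ F w d)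
    (x : 𝔡) (n : ℤ) (c : ι → ι → ℂ) :
    superComm 1 ((cur x).1 n) (fermionBilinear bar w c) = 0 := by
  simp [fermionBilinear_apply, superComm_even_normalProd, hc.cur_bar, hb.lie_w]

theorem hasContraction_fermionBilinear_barw (hc : CurrentSystem B cur bar)
    (hb : AdaptedFrame B σ F w d) (c : ι → ι → ℂ) (l : ι) :
    HasContraction 1 0 (fermionBilinear bar w c) (bar (w l)) :=
  hasContraction_zero_iff.2 fun m => by
    rw [superComm_flip (C := 0) (mul_one 1), map_zero, smul_zero]
    simp [hc.barw_fermionBilinear hb]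

/-! #### Commutators of the `U(1)` current -/

omit [DecidableEq ι] in
theorem bar_jField (hc : CurrentSystem B cur bar) (x : 𝔡) (n : ℤ) :
    superComm 1 ((bar x).1 n) (jField bar σ w d)
      = shift n (bar (∑ k, σ k • (B x (d k) • w k - B x (w k) • d k))) := by
  simp only [jField, map_sum, map_smul, superComm_odd_normalProd_odd_odd, hc.superComm_bar_bar,
    LinearMap.smul_apply, normalProd_shift_oneField_left, normalProd_shift_oneField_right, map_sub]

theorem jField_barw (hc : CurrentSystem B cur bar) (hb : AdaptedFrame B σ F w d) (l : ι) (m : ℤ) :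
    superComm 1 ((jField bar σ w d).1 m) (bar (w l)) = -σ l • shift m (bar (w l)) := by
  rw [superComm_flip (mul_one 1) (hc.bar_jField (w l))]
  simp only [hb.ww, hb.wd, zero_smul, sub_zero, ite_smul, one_smul, smul_ite, smul_zero,
    Finset.sum_ite_eq, Finset.mem_univ, if_true, map_smul]
  module

theorem jField_bard (hc : CurrentSystem B cur bar) (hb : AdaptedFrame B σ F w d) (l : ι) (m : ℤ) :
    superComm 1 ((jField bar σ w d).1 m) (bar (d l)) = σ l • shift m (bar (d l)) := by
  rw [superComm_flip (mul_one 1) (hc.bar_jField (d l))]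
  simp [hb.dw, hb.dd]

theorem jField_curw (hc : CurrentSystem B cur bar) (hb : AdaptedFrame B σ F w d) (l : ι) (m : ℤ) :
    superComm 1 ((jField bar σ w d).1 m) (cur (w l)) = 0 := by
  rw [superComm_flip (C := 0) (mul_one 1), map_zero, smul_zero]
  simp [jField, superComm_even_normalProd, hc.cur_bar, hb.w_lie]

theorem jField_curd (hc : CurrentSystem B cur bar) (hb : AdaptedFrame B σ F w d) (l : ι) (m : ℤ) :
    superComm 1 ((jField bar σ w d).1 m) (cur (d l)) = shift m (qField bar σ F w l) := by
  have curd_jField (n : ℤ) : superComm 1 ((cur (d l)).1 n) (jField bar σ w d)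
      = shift n (-qField bar σ F w l) := by
    simp only [jField, qField, fermionBilinear_apply, map_sum, map_neg, map_smul,
      superComm_even_normalProd, hc.cur_bar, hb.lie_w, hb.d_lie_d, LinearMap.sum_apply,
      LinearMap.smul_apply, map_zero, add_zero, Finset.smul_sum, ← Finset.sum_neg_distrib,
      (hc.hasContraction_barw_barw hb _ _).zero_normalProd_shift_left]
    rw [Finset.sum_comm]
    refine Finset.sum_congr rfl fun i _ => Finset.sum_congr rfl fun j _ => ?_
    rw [hb.swap_right l j i]
    module
  rw [superComm_flip (mul_one 1) curd_jField, map_neg]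
  module

theorem jField_jField (hc : CurrentSystem B cur bar) (hb : AdaptedFrame B σ F w d) (m : ℤ) :
    superComm 1 ((jField bar σ w d).1 m) (jField bar σ w d)
      = (Fintype.card ι * m : ℂ) • shift (m - 1) (oneField M) := by
  have summand (k : ι) : superComm 1 ((jField bar σ w d).1 m)
      (σ k • normalProd (-1) (bar (d k)) (bar (w k))) = (m : ℂ) • shift (m - 1) (oneField M) := by
    rw [map_smul, superComm_even_normalProd, hc.jField_bard hb, hc.jField_barw hb, map_smul,
      map_smul, LinearMap.smul_apply, normalProd_shift_right,
      normalProd_shift_left (hc.hasContraction_bard_barw hb k)]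
    linear_combination (norm := module) hb.sq k • (m : ℂ) • shift (m - 1) (oneField M)
  nth_rewrite 2 [jField]
  rw [map_sum, Finset.sum_congr rfl fun k _ => summand k, Finset.sum_const, Finset.card_univ,
    ← Nat.cast_smul_eq_nsmul ℂ, smul_smul]

theorem jField_fermionBilinear (hc : CurrentSystem B cur bar) (hb : AdaptedFrame B σ F w d)
    (m : ℤ) (c : ι → ι → ℂ) :
    superComm 1 ((jField bar σ w d).1 m) (fermionBilinear bar w c)
      = shift m (fermionBilinear bar w fun i j => -(σ i + σ j) * c i j) := by
  simp only [fermionBilinear_apply, map_sum, map_smul]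
  refine Finset.sum_congr rfl fun i _ => Finset.sum_congr rfl fun j _ => ?_
  rw [superComm_even_normalProd, hc.jField_barw hb, hc.jField_barw hb, map_smul, map_smul,
    LinearMap.smul_apply, normalProd_shift_right,
    (hc.hasContraction_barw_barw hb i j).zero_normalProd_shift_left]
  module

theorem jField_qField (hc : CurrentSystem B cur bar) (hb : AdaptedFrame B σ F w d) (l : ι)
    (m : ℤ) : superComm 1 ((jField bar σ w d).1 m) (qField bar σ F w l)
      = (2 * σ l) • shift m (qField bar σ F w l) := by
  rw [qField, hc.jField_fermionBilinear hb, ← map_smul, ← map_smul]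
  refine congrArg _ (hc.fermionBilinear_congr hb fun i j => ?_)
  simp only [Pi.smul_apply, smul_eq_mul]
  rw [hb.swap_right l j i]
  linear_combination (-2) * hb.charge l i j - F l i j * hb.sq i - F l i j * hb.sq j

theorem jField_normalProd_qField_barw (hc : CurrentSystem B cur bar)
    (hb : AdaptedFrame B σ F w d) (k : ι) (m : ℤ) :
    superComm 1 ((jField bar σ w d).1 m) (normalProd 1 (qField bar σ F w k) (bar (w k)))
      = σ k • shift m (normalProd 1 (qField bar σ F w k) (bar (w k))) := by
  rw [superComm_even_normalProd, hc.jField_qField hb, hc.jField_barw hb, map_smul, map_smul,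
    LinearMap.smul_apply, normalProd_shift_right, qField,
    (hc.hasContraction_fermionBilinear_barw hb _ k).zero_normalProd_shift_left]
  module

theorem jField_normalProd_curd_barw (hc : CurrentSystem B cur bar)
    (hb : AdaptedFrame B σ F w d) (k : ι) (m : ℤ) :
    superComm 1 ((jField bar σ w d).1 m) (normalProd 1 (cur (d k)) (bar (w k)))
      = shift m (normalProd 1 (qField bar σ F w k) (bar (w k))
        - σ k • normalProd 1 (cur (d k)) (bar (w k))) := by
  rw [superComm_even_normalProd, hc.jField_curd hb, hc.jField_barw hb, map_smul,
    normalProd_shift_right, qField,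
    (hc.hasContraction_fermionBilinear_barw hb _ k).zero_normalProd_shift_left, map_sub, map_smul]
  module

theorem jField_normalProd_curw_bard (hc : CurrentSystem B cur bar)
    (hb : AdaptedFrame B σ F w d) (k : ι) (m : ℤ) :
    superComm 1 ((jField bar σ w d).1 m) (normalProd 1 (cur (w k)) (bar (d k)))
      = σ k • shift m (normalProd 1 (cur (w k)) (bar (d k))) := by
  rw [superComm_even_normalProd, hc.jField_curw hb, hc.jField_bard hb, map_zero,
    LinearMap.zero_apply, zero_add, map_smul, normalProd_shift_right]

theorem jField_hField (hc : CurrentSystem B cur bar) (hb : AdaptedFrame B σ F w d) (m : ℤ) :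
    superComm 1 ((jField bar σ w d).1 m) (hField cur bar σ w d)
      = -shift m (kField cur bar σ F w d) := by
  simp only [hField, kField, map_sum, map_smul, map_sub, map_add, ← Finset.sum_neg_distrib,
    hc.jField_normalProd_curd_barw hb, hc.jField_normalProd_curw_bard hb]
  refine Finset.sum_congr rfl fun k _ => ?_
  linear_combination (norm := module) -hb.sq k •
    (shift m (normalProd 1 (cur (d k)) (bar (w k)))
      + shift m (normalProd 1 (cur (w k)) (bar (d k))))

theorem jField_kField (hc : CurrentSystem B cur bar) (hb : AdaptedFrame B σ F w d) (m : ℤ) :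
    superComm 1 ((jField bar σ w d).1 m) (kField cur bar σ F w d)
      = -shift m (hField cur bar σ w d) := by
  simp only [hField, kField, map_sum, map_smul, map_sub, map_add, ← Finset.sum_neg_distrib,
    hc.jField_normalProd_curd_barw hb, hc.jField_normalProd_curw_bard hb,
    hc.jField_normalProd_qField_barw hb]
  refine Finset.sum_congr rfl fun k _ => ?_
  linear_combination (norm := module) -hb.sq k •
    shift m (normalProd 1 (qField bar σ F w k) (bar (w k)))

/-! #### Commutators of the supercurrent -/

theorem barw_kField (hc : CurrentSystem B cur bar) (hb : AdaptedFrame B σ F w d) (l : ι) (n : ℤ) :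
    superComm (-1) ((bar (w l)).1 n) (kField cur bar σ F w d) = shift n (cur (w l)) := by
  simp only [kField, map_sum, map_add, map_sub, map_smul, superComm_odd_normalProd_even_odd,
    hc.bar_cur, hc.superComm_bar_bar, qField, hc.barw_fermionBilinear hb, hb.w_lie, hb.ww, hb.wd,
    normalProd_shift_oneField_right, map_zero, LinearMap.zero_apply, zero_smul]
  simp

theorem bard_kField (hc : CurrentSystem B cur bar) (hb : AdaptedFrame B σ F w d) (l : ι) (n : ℤ) :
    superComm (-1) ((bar (d l)).1 n) (kField cur bar σ F w d) = shift n (cur (d l)) := by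
  have cubic : (fermionBilinear bar w fun i j => F l j i - σ j * ((σ i + σ l) * F j l i))
      = σ l • qField bar σ F w l := by
    rw [qField, ← map_smul]
    refine hc.fermionBilinear_congr hb fun i j => ?_
    simp only [Pi.smul_apply, smul_eq_mul]
    rw [← hb.cyclic l i j, ← hb.cyclic l j i, hb.swap_right l j i]
    linear_combination (-2) * hb.charge l i j
  have bard_qField (k : ι) : superComm 1 ((bar (d l)).1 n) (qField bar σ F w k)
      = shift n (∑ j, (σ j * F k l j - σ l * F k j l) • bar (w j)) :=
    hc.bard_fermionBilinear hb l n _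
  have hcubic : ∑ j, ∑ i, (F l j i • shift n (normalProd (-1) (bar (w i)) (bar (w j)))
      - σ j • (σ i * F j l i - σ l * F j i l) • shift n (normalProd (-1) (bar (w i)) (bar (w j))))
      = σ l • shift n (qField bar σ F w l) := by
    rw [← map_smul, ← cubic, fermionBilinear_apply, map_sum, Finset.sum_comm]
    refine Finset.sum_congr rfl fun i _ => ?_
    rw [map_sum]
    refine Finset.sum_congr rfl fun j _ => ?_
    rw [map_smul, hb.swap_right j i l]
    module
  simp only [kField, map_sum, map_add, map_sub, map_smul, superComm_odd_normalProd_even_odd,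
    hc.bar_cur, hc.superComm_bar_bar, hb.lie_w, hb.d_lie_d,
    hb.dw, hb.dd, normalProd_shift_oneField_right, map_zero, LinearMap.zero_apply, zero_smul,
    bard_qField, LinearMap.sum_apply, LinearMap.smul_apply,
    (hc.hasContraction_barw_barw hb _ _).zero_normalProd_shift_left]
  simp only [ite_smul, one_smul, zero_smul, add_zero, smul_add, smul_ite, smul_zero,
    Finset.smul_sum, Finset.sum_add_distrib, Finset.sum_sub_distrib, Finset.sum_ite_eq,
    Finset.mem_univ, if_true] at hcubic ⊢
  rw [← hcubic]
  module

theorem curw_kField (hc : CurrentSystem B cur bar) (hb : AdaptedFrame B σ F w d) (l : ι) (n : ℤ) :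
    superComm 1 ((cur (w l)).1 n) (kField cur bar σ F w d)
      = (n : ℂ) • shift (n - 1) (bar (w l)) := by
  simp only [kField, map_sum, map_add, map_sub, map_smul, superComm_even_normalProd, hc.cur_cur,
    hc.cur_bar, qField, hc.cur_fermionBilinear hb, hb.w_lie, hb.ww, hb.wd, map_zero,
    LinearMap.zero_apply, LinearMap.smul_apply, LinearMap.add_apply, normalProd_shift_oneField_left]
  simp

theorem curd_kField (hc : CurrentSystem B cur bar) (hb : AdaptedFrame B σ F w d) (l : ι) (n : ℤ) :
    superComm 1 ((cur (d l)).1 n) (kField cur bar σ F w d)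
      = (n : ℂ) • shift (n - 1) (bar (d l)) := by
  have cancel : ∑ k, ∑ j, F l k j • shift n (normalProd 1 (cur (w j)) (bar (w k)))
      = -∑ k, ∑ j, F l k j • shift n (normalProd 1 (cur (w k)) (bar (w j))) := by
    rw [Finset.sum_comm]
    simp only [← Finset.sum_neg_distrib]
    refine Finset.sum_congr rfl fun k _ => Finset.sum_congr rfl fun j _ => ?_
    rw [hb.swap_right l j k]
    module
  simp only [kField, map_sum, map_add, map_sub, map_smul, superComm_even_normalProd, hc.cur_cur,
    hc.cur_bar, qField, hc.cur_fermionBilinear hb, hb.lie_w, hb.d_lie_d, hb.dw, hb.dd, map_zero,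
    LinearMap.zero_apply, LinearMap.smul_apply, LinearMap.add_apply, normalProd_shift_oneField_left]
  simp only [LinearMap.sum_apply, LinearMap.smul_apply, normalProd_shift_right,
    (hc.hasContraction_curw_bar hb _ _).zero_normalProd_shift_left]
  simp [Finset.sum_add_distrib, cancel]

theorem kField_barw (hc : CurrentSystem B cur bar) (hb : AdaptedFrame B σ F w d) (l : ι) (m : ℤ) :
    superComm (-1) ((kField cur bar σ F w d).1 m) (bar (w l)) = shift m (cur (w l)) := by
  rw [superComm_flip (by norm_num) (hc.barw_kField hb l), neg_neg, one_smul]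

theorem kField_bard (hc : CurrentSystem B cur bar) (hb : AdaptedFrame B σ F w d) (l : ι) (m : ℤ) :
    superComm (-1) ((kField cur bar σ F w d).1 m) (bar (d l)) = shift m (cur (d l)) := by
  rw [superComm_flip (by norm_num) (hc.bard_kField hb l), neg_neg, one_smul]

theorem kField_curw (hc : CurrentSystem B cur bar) (hb : AdaptedFrame B σ F w d) (l : ι) (m : ℤ) :
    superComm 1 ((kField cur bar σ F w d).1 m) (cur (w l)) = der (shift m (bar (w l))) :=
  superComm_flip_der (hc.curw_kField hb l) m

theorem kField_curd (hc : CurrentSystem B cur bar) (hb : AdaptedFrame B σ F w d) (l : ι) (m : ℤ) :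
    superComm 1 ((kField cur bar σ F w d).1 m) (cur (d l)) = der (shift m (bar (d l))) :=
  superComm_flip_der (hc.curd_kField hb l) m

theorem hasContraction_normalProd_curw_barw (hc : CurrentSystem B cur bar)
    (hb : AdaptedFrame B σ F w d) (i j k : ι) :
    HasContraction (-1) 0 (normalProd 1 (cur (w i)) (bar (w j))) (bar (w k)) :=
  hasContraction_zero_iff.2 fun m => by
    rw [superComm_flip (C := 0) (by norm_num), map_zero, smul_zero]
    simp [superComm_odd_normalProd_even_odd, hc.bar_cur, hc.superComm_bar_bar, hb.w_lie, hb.ww]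

theorem kField_fermionBilinear (hc : CurrentSystem B cur bar) (hb : AdaptedFrame B σ F w d)
    (m : ℤ) (c : ι → ι → ℂ) :
    superComm 1 ((kField cur bar σ F w d).1 m) (fermionBilinear bar w c)
      = shift m (∑ i, ∑ j, (c i j - c j i) • normalProd 1 (cur (w i)) (bar (w j))) := by
  have swap (i j : ι) :
      normalProd 1 (bar (w i)) (cur (w j)) = normalProd 1 (cur (w j)) (bar (w i)) := by
    rw [normalProd_swap (mul_one 1) (hc.hasContraction_curw_bar hb j (w i)), one_smul]
  simp only [fermionBilinear_apply, map_sum, map_smul, superComm_odd_normalProd_odd_odd,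
    hc.kField_barw hb, (hc.hasContraction_curw_bar hb _ _).zero_normalProd_shift_left,
    normalProd_shift_right, swap, smul_sub, Finset.sum_sub_distrib]
  rw [Finset.sum_comm (f := fun i j => c i j • shift m (normalProd 1 (cur (w j)) (bar (w i))))]
  simp only [← Finset.sum_sub_distrib]
  exact Finset.sum_congr rfl fun i _ => Finset.sum_congr rfl fun j _ => by module

theorem kField_normalProd_fermionBilinear_barw (hc : CurrentSystem B cur bar)
    (hb : AdaptedFrame B σ F w d) (c : ι → ι → ℂ) (k : ι) :
    ∃ U : quantumFields M, ∀ m : ℤ, superComm (-1) ((kField cur bar σ F w d).1 m)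
      (normalProd 1 (fermionBilinear bar w c) (bar (w k))) = shift m U := by
  refine ⟨normalProd (-1) (∑ i, ∑ j, (c i j - c j i) • normalProd 1 (cur (w i)) (bar (w j)))
    (bar (w k)) + normalProd 1 (fermionBilinear bar w c) (cur (w k)), fun m => ?_⟩
  rw [superComm_odd_normalProd_even_odd, hc.kField_fermionBilinear hb, hc.kField_barw hb,
    normalProd_shift_right, map_add]
  simp only [map_sum, map_smul, LinearMap.sum_apply, LinearMap.smul_apply,
    (hc.hasContraction_normalProd_curw_barw hb _ _ k).zero_normalProd_shift_left]

theorem kField_normalProd_cur_bar (hc : CurrentSystem B cur bar) (hb : AdaptedFrame B σ F w d)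
    (k : ι) : ∃ T : quantumFields M, ∀ m : ℤ, superComm (-1) ((kField cur bar σ F w d).1 m)
      (normalProd 1 (cur (d k)) (bar (w k)) + normalProd 1 (cur (w k)) (bar (d k)))
      = shift m T + (m * (m - 1) : ℂ) • shift (m - 2) (oneField M) := by
  refine ⟨normalProd (-1) (der (bar (d k))) (bar (w k)) + normalProd 1 (cur (d k)) (cur (w k))
    + (normalProd (-1) (der (bar (w k))) (bar (d k)) + normalProd 1 (cur (w k)) (cur (d k))),
    fun m => ?_⟩
  rw [map_add, superComm_odd_normalProd_even_odd, superComm_odd_normalProd_even_odd,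
    hc.kField_curd hb, hc.kField_curw hb, hc.kField_barw hb, hc.kField_bard hb,
    normalProd_der_shift_left (hc.hasContraction_bard_barw hb k),
    normalProd_der_shift_left (hc.hasContraction_barw_bard hb k),
    normalProd_swap (by norm_num) (hc.hasContraction_bard_barw hb k),
    normalProd_shift_right, normalProd_shift_right]
  simp only [map_add, map_smul]
  module

theorem kField_kField (hc : CurrentSystem B cur bar) (hb : AdaptedFrame B σ F w d) (m : ℤ) :
    superComm (-1) ((kField cur bar σ F w d).1 m) (kField cur bar σ F w d)
      = (2 : ℂ) • shift m (sField cur bar σ F w d)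
        + (Fintype.card ι * m * (m - 1) : ℂ) • shift (m - 2) (oneField M) := by
  choose T hT using hc.kField_normalProd_cur_bar hb
  choose U hU using fun k =>
    hc.kField_normalProd_fermionBilinear_barw hb (fun i j => σ j * F k i j) k
  have expand (m : ℤ) : superComm (-1) ((kField cur bar σ F w d).1 m) (kField cur bar σ F w d)
      = shift m (∑ k, (T k - σ k • U k))
        + (Fintype.card ι * m * (m - 1) : ℂ) • shift (m - 2) (oneField M) := by
    nth_rewrite 2 [kField]
    simp only [map_sum, map_sub, map_smul, hT, qField, hU]
    simp only [Finset.sum_add_distrib, Finset.sum_sub_distrib, Finset.sum_const,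
      Finset.card_univ, ← Nat.cast_smul_eq_nsmul ℂ]
    module
  rw [expand, sField, expand 0]
  simp

theorem sField_jField (hc : CurrentSystem B cur bar) (hb : AdaptedFrame B σ F w d) (p : ℤ) :
    superComm 1 ((sField cur bar σ F w d).1 p) (jField bar σ w d)
      = der (shift p (jField bar σ w d)) := by
  have summand (k : ι) : superComm 1 ((sField cur bar σ F w d).1 p)
      (normalProd (-1) (bar (d k)) (bar (w k)))
      = der (shift p (normalProd (-1) (bar (d k)) (bar (w k)))) := by
    rw [sField, superComm_even_normalProd,
      superComm_half_anticomm (hc.kField_bard hb k) (hc.kField_curd hb k),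
      superComm_half_anticomm (hc.kField_barw hb k) (hc.kField_curw hb k), der_shift p (bar (w k)),
      der_shift p (normalProd _ _ _), der_normalProd]
    simp only [map_sub, map_add, map_smul, LinearMap.sub_apply, LinearMap.smul_apply,
      normalProd_der_shift_left (hc.hasContraction_bard_barw hb k), normalProd_shift_right,
      normalProd_shift_left (hc.hasContraction_bard_barw hb k), Int.cast_sub, Int.cast_one]
    rw [show p - 1 - 1 = p - 2 by ring]
    module
  simp only [jField, map_sum, map_smul, summand]

theorem seed (hc : CurrentSystem B cur bar) (hb : AdaptedFrame B σ F w d) :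
    N2Seed (Fintype.card ι) (jField bar σ w d).1 (kField cur bar σ F w d).1
      (hField cur bar σ w d).1 (sField cur bar σ F w d).1 := by
  have mode {X Y : quantumFields M} (h : X = Y) (n : ℤ) : X.1 n = Y.1 n := by rw [h]
  have one_eq : (oneField M).1 = idField := rfl
  refine ⟨fun m n => ?_, fun m n => ?_, fun m n => ?_, fun m n => ?_, fun m n => ?_⟩
  · rw [show m + n - 1 = n + (m - 1) by ring]
    simpa [superComm_apply, one_eq] using mode (hc.jField_jField hb m) n
  · simpa [superComm_apply, add_comm m n] using mode (hc.jField_kField hb m) n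
  · simpa [superComm_apply, add_comm m n] using mode (hc.jField_hField hb m) n
  · rw [show m + n - 2 = n + (m - 2) by ring]
    simpa [superComm_apply, one_eq, add_comm m n] using mode (hc.kField_kField hb m) n
  · rw [show m + n - 1 = n - 1 + m by ring]
    simpa [superComm_apply] using mode (hc.sField_jField hb m) n

end CurrentSystem

end Construction

/-! ### Parity and generation -/

section GradedSpaces

variable {M : Type*} [AddCommGroup M] [Module ℂ M]

/-- A `ℤ/2`-graded space of fields closed under the products `A₍₋₁₎B` and `A₍₀₎B`. -/
structure IsProductClosed (V : ZMod 2 → Submodule ℂ (quantumFields M)) : Prop where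
  normalProd_mem : ∀ {p q A B}, A ∈ V p → B ∈ V q → normalProd (koszul p q) A B ∈ V (p + q)
  superComm_mem : ∀ {p q A B}, A ∈ V p → B ∈ V q →
    superComm (koszul p q) (A.1 0) B ∈ V (p + q)

theorem isProductClosed_parityFields (S : ZMod 2 → Submodule ℂ M) :
    IsProductClosed (parityFields S) where
  normalProd_mem {p q A B} hA hB n r v hv := by
    obtain ⟨N, hN⟩ := (eventually_normalProd_apply_eq_sum (koszul p q) A B n v).exists
    rw [hN]
    refine sum_mem fun j _ => add_mem ?_ (Submodule.smul_mem _ _ ?_)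
    · rw [add_assoc]; exact hA _ _ _ (hB _ _ _ hv)
    · rw [add_comm p, add_assoc]; exact hB _ _ _ (hA _ _ _ hv)
  superComm_mem {p q A B} hA hB n r v hv := by
    refine sub_mem ?_ (Submodule.smul_mem _ _ ?_)
    · rw [add_assoc]; exact hA _ _ _ (hB _ _ _ hv)
    · rw [add_comm p, add_assoc]; exact hB _ _ _ (hA _ _ _ hv)

/-- The part of parity `p` of the vertex superalgebra generated by the fields `even a` and
`odd a`. Some `odd a` is needed for the zero field to be generated in odd parity. -/
def generatedFields {ι : Type*} [Nonempty ι] (even odd : ι → FormalDist M) (p : ZMod 2) :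
    Submodule ℂ (quantumFields M) where
  carrier := {A | MemGenerated even odd p A.1}
  add_mem' hA hB := .add hA hB
  zero_mem' := by
    have zero_mem {A : FormalDist M} (hA : MemGenerated even odd p A) :
        MemGenerated even odd p 0 := by simpa using hA.smul 0
    fin_cases p
    · exact zero_mem .one
    · exact zero_mem (.odd (Classical.arbitrary ι))
  smul_mem' c _ hA := .smul c hA

theorem isProductClosed_generatedFields {ι : Type*} [Nonempty ι] (even odd : ι → FormalDist M) :
    IsProductClosed (generatedFields even odd) where
  normalProd_mem {p q A B} hA hB :=
    .prod (-1) hA hB fun n v => (normalOrd_eq_normalProd p q A B n v).symm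
  superComm_mem {p q A B} hA hB := .prod 0 hA hB fun n v => by
    rw [nthProd, finsum_eq_single _ 0 fun j hj => ?_]
    · simp [superComm_apply]
    · rw [Ring.choose_zero_pos _ (Nat.pos_of_ne_zero hj)]
      simp

namespace IsProductClosed

variable {V : ZMod 2 → Submodule ℂ (quantumFields M)} {A B : quantumFields M}

theorem normalProd_odd_odd_mem (hV : IsProductClosed V) (hA : A ∈ V 1) (hB : B ∈ V 1) :
    normalProd (-1) A B ∈ V 0 := by
  have h := hV.normalProd_mem hA hB
  rw [koszul_one_one] at h
  exact h

theorem normalProd_even_odd_mem (hV : IsProductClosed V) (hA : A ∈ V 0) (hB : B ∈ V 1) :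
    normalProd 1 A B ∈ V 1 := by
  simpa only [koszul_zero_left, zero_add] using hV.normalProd_mem hA hB

variable {𝔡 ι : Type*} [AddCommGroup 𝔡] [Module ℂ 𝔡] [Fintype ι]
  {cur bar : 𝔡 →ₗ[ℂ] quantumFields M}

theorem jField_mem (hV : IsProductClosed V) (hbar : ∀ x, bar x ∈ V 1) (σ : ι → ℂ) (w d : ι → 𝔡) :
    jField bar σ w d ∈ V 0 :=
  sum_mem fun _ _ => Submodule.smul_mem _ _ (hV.normalProd_odd_odd_mem (hbar _) (hbar _))

theorem hField_mem (hV : IsProductClosed V) (hcur : ∀ x, cur x ∈ V 0) (hbar : ∀ x, bar x ∈ V 1)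
    (σ : ι → ℂ) (w d : ι → 𝔡) : hField cur bar σ w d ∈ V 1 :=
  sum_mem fun _ _ => Submodule.smul_mem _ _ (sub_mem
    (hV.normalProd_even_odd_mem (hcur _) (hbar _)) (hV.normalProd_even_odd_mem (hcur _) (hbar _)))

theorem qField_mem (hV : IsProductClosed V) (hbar : ∀ x, bar x ∈ V 1) (σ : ι → ℂ)
    (F : ι → ι → ι → ℂ) (w : ι → 𝔡) (l : ι) : qField bar σ F w l ∈ V 0 :=
  sum_mem fun _ _ => sum_mem fun _ _ =>
    Submodule.smul_mem _ _ (hV.normalProd_odd_odd_mem (hbar _) (hbar _))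

theorem kField_mem (hV : IsProductClosed V) (hcur : ∀ x, cur x ∈ V 0) (hbar : ∀ x, bar x ∈ V 1)
    (σ : ι → ℂ) (F : ι → ι → ι → ℂ) (w d : ι → 𝔡) : kField cur bar σ F w d ∈ V 1 :=
  sum_mem fun k _ => sub_mem
    (add_mem (hV.normalProd_even_odd_mem (hcur _) (hbar _))
      (hV.normalProd_even_odd_mem (hcur _) (hbar _)))
    (Submodule.smul_mem _ _
      (hV.normalProd_even_odd_mem (hV.qField_mem hbar σ F w k) (hbar _)))

theorem sField_mem (hV : IsProductClosed V) (hcur : ∀ x, cur x ∈ V 0) (hbar : ∀ x, bar x ∈ V 1)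
    (σ : ι → ℂ) (F : ι → ι → ι → ℂ) (w d : ι → 𝔡) : sField cur bar σ F w d ∈ V 0 := by
  have hK := hV.kField_mem hcur hbar σ F w d
  have hKK := hV.superComm_mem hK hK
  rw [koszul_one_one] at hKK
  exact Submodule.smul_mem _ _ hKK

end IsProductClosed

end GradedSpaces

/-! ### The currents on the space of states -/

section States

open Filter

/-- The projection of the free algebra on the modes of the currents onto the enveloping algebra. -/
def freeToEnvelope : FreeAlgebra ℂ Gen →ₐ[ℂ] Envelope := RingQuot.mkAlgHom ℂ AffineRel

/-- The action on the states of the free algebra on the modes of the currents. -/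
def modeAction : FreeAlgebra ℂ Gen →ₐ[ℂ] Module.End ℂ States :=
  (Algebra.lsmul ℂ ℂ States).comp freeToEnvelope

@[simp] theorem modeAction_cur (a : DLieC) (n : ℤ) :
    modeAction (FreeAlgebra.ι ℂ (.cur a n)) = current a n := rfl

@[simp] theorem modeAction_bar (a : DLieC) (n : ℤ) :
    modeAction (FreeAlgebra.ι ℂ (.bar a n)) = oddCurrent a n := rfl

theorem modeAction_eq_of_rel {x y : FreeAlgebra ℂ Gen} (h : AffineRel x y) :
    modeAction x = modeAction y :=
  congrArg (Algebra.lsmul ℂ ℂ States)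
    (show freeToEnvelope x = freeToEnvelope y from RingQuot.mkAlgHom_rel ℂ h)

theorem current_add (a b : DLieC) (n : ℤ) : current (a + b) n = current a n + current b n := by
  simpa using modeAction_eq_of_rel (.cur_add a b n)

theorem current_smul (c : ℂ) (a : DLieC) (n : ℤ) : current (c • a) n = c • current a n := by
  simpa using modeAction_eq_of_rel (.cur_smul c a n)

theorem oddCurrent_add (a b : DLieC) (n : ℤ) :
    oddCurrent (a + b) n = oddCurrent a n + oddCurrent b n := by
  simpa using modeAction_eq_of_rel (.bar_add a b n)

theorem oddCurrent_smul (c : ℂ) (a : DLieC) (n : ℤ) :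
    oddCurrent (c • a) n = c • oddCurrent a n := by
  simpa using modeAction_eq_of_rel (.bar_smul c a n)

theorem comm_current_current (a b : DLieC) (m n : ℤ) :
    current a m * current b n - current b n * current a m
      = current ⁅a, b⁆ (m + n)
        + (if m + n = 0 then (m : ℂ) * pairingC a b else 0) • (1 : Module.End ℂ States) := by
  have h := modeAction_eq_of_rel (.cur_cur a b m n)
  rw [map_sub, map_mul, map_mul, map_add, AlgHom.commutes, Algebra.algebraMap_eq_smul_one] at h
  exact h

theorem comm_current_oddCurrent (a b : DLieC) (m n : ℤ) :
    current a m * oddCurrent b n - oddCurrent b n * current a m = oddCurrent ⁅a, b⁆ (m + n) := by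
  have h := modeAction_eq_of_rel (.cur_bar a b m n)
  rw [map_sub, map_mul, map_mul] at h
  exact h

theorem anticomm_oddCurrent_oddCurrent (a b : DLieC) (m n : ℤ) :
    oddCurrent a m * oddCurrent b n + oddCurrent b n * oddCurrent a m
      = (if m + n = -1 then pairingC a b else 0) • (1 : Module.End ℂ States) := by
  have h := modeAction_eq_of_rel (.bar_bar a b m n)
  rw [map_add, map_mul, map_mul, AlgHom.commutes, Algebra.algebraMap_eq_smul_one] at h
  exact h

theorem toStates_tmul (u : Envelope) (f : SmoothFunctions) :
    toStates (u ⊗ₜ[ℂ] f) = u • toStates (1 ⊗ₜ[ℂ] f) := by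
  rw [← map_smul, TensorProduct.smul_tmul', smul_eq_mul, mul_one]

theorem states_submodule_eq_top (N : Submodule ℂ States)
    (h_functions : ∀ f : SmoothFunctions, toStates (1 ⊗ₜ[ℂ] f) ∈ N)
    (h_current : ∀ a n, ∀ v ∈ N, current a n v ∈ N)
    (h_oddCurrent : ∀ a n, ∀ v ∈ N, oddCurrent a n v ∈ N) : N = ⊤ := by
  have modeAction_mem (u : FreeAlgebra ℂ Gen) : ∀ v ∈ N, modeAction u v ∈ N := by
    induction u using FreeAlgebra.induction with
    | grade0 c => intro v hv; simpa using N.smul_mem c hv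
    | grade1 g =>
      cases g with
      | cur a n => exact h_current a n
      | bar a n => exact h_oddCurrent a n
    | mul x y hx hy => intro v hv; simpa using hx _ (hy v hv)
    | add x y hx hy => intro v hv; simpa using add_mem (hx v hv) (hy v hv)
  refine eq_top_iff.2 fun v _ => ?_
  obtain ⟨t, rfl⟩ : ∃ t, toStates t = v := Submodule.mkQ_surjective inducedRelations v
  induction t using TensorProduct.induction_on with
  | zero => simp
  | add x y hx hy => rw [map_add]; exact add_mem (hx trivial) (hy trivial)
  | tmul e f =>
    obtain ⟨u, rfl⟩ : ∃ u, freeToEnvelope u = e := RingQuot.mkAlgHom_surjective ℂ AffineRel e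
    rw [toStates_tmul]
    exact modeAction_mem u _ (h_functions f)

/-- The states annihilated by the modes of large degree of every current. -/
def smoothStates : Submodule ℂ States where
  carrier := {v | ∀ a, (∀ᶠ n : ℤ in atTop, current a n v = 0) ∧
    ∀ᶠ n : ℤ in atTop, oddCurrent a n v = 0}
  add_mem' {v w} hv hw a := by
    constructor
    · filter_upwards [(hv a).1, (hw a).1] with n h₁ h₂
      rw [map_add, h₁, h₂, add_zero]
    · filter_upwards [(hv a).2, (hw a).2] with n h₁ h₂
      rw [map_add, h₁, h₂, add_zero]
  zero_mem' a := by simp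
  smul_mem' c v hv a := by
    constructor
    · filter_upwards [(hv a).1] with n h
      rw [map_smul, h, smul_zero]
    · filter_upwards [(hv a).2] with n h
      rw [map_smul, h, smul_zero]

theorem toStates_one_tmul_mem_smoothStates (f : SmoothFunctions) :
    toStates (1 ⊗ₜ[ℂ] f) ∈ smoothStates := by
  intro a
  constructor
  · filter_upwards [eventually_gt_atTop 0] with n hn
    exact (toStates_tmul _ f).symm.trans ((Submodule.Quotient.mk_eq_zero _).2
      (Submodule.subset_span (Or.inl (Or.inl ⟨a, n, f, hn, rfl⟩))))
  · filter_upwards [eventually_ge_atTop 0] with n hn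
    exact (toStates_tmul _ f).symm.trans ((Submodule.Quotient.mk_eq_zero _).2
      (Submodule.subset_span (Or.inl (Or.inr ⟨a, n, f, hn, rfl⟩))))

theorem eventually_comp_add_right {P : ℤ → Prop} (h : ∀ᶠ n : ℤ in atTop, P n) (m : ℤ) :
    ∀ᶠ n : ℤ in atTop, P (n + m) :=
  (tendsto_atTop_add_const_right atTop m tendsto_id).eventually h

theorem current_apply_mem_smoothStates (b : DLieC) (m : ℤ) {v : States} (hv : v ∈ smoothStates) :
    current b m v ∈ smoothStates := by
  intro a
  constructor
  · filter_upwards [(hv a).1, eventually_comp_add_right (hv ⁅a, b⁆).1 m,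
      eventually_gt_atTop (-m)] with n ha hab hn
    simpa [ha, hab, show n + m ≠ 0 by omega] using
      LinearMap.congr_fun (comm_current_current a b n m) v
  · filter_upwards [(hv a).2, eventually_comp_add_right (hv ⁅b, a⁆).2 m] with n ha hba
    simpa [ha, hba, add_comm m n] using LinearMap.congr_fun (comm_current_oddCurrent b a m n) v

theorem oddCurrent_apply_mem_smoothStates (b : DLieC) (m : ℤ) {v : States}
    (hv : v ∈ smoothStates) : oddCurrent b m v ∈ smoothStates := by
  intro a
  constructor
  · filter_upwards [(hv a).1, eventually_comp_add_right (hv ⁅a, b⁆).2 m] with n ha hab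
    simpa [ha, hab] using LinearMap.congr_fun (comm_current_oddCurrent a b n m) v
  · filter_upwards [(hv a).2, eventually_gt_atTop (-1 - m)] with n ha hn
    simpa [ha, show n + m ≠ -1 by omega] using
      LinearMap.congr_fun (anticomm_oddCurrent_oddCurrent a b n m) v

theorem smoothStates_eq_top : smoothStates = ⊤ :=
  states_submodule_eq_top smoothStates toStates_one_tmul_mem_smoothStates
    (fun a n _ => current_apply_mem_smoothStates a n)
    (fun a n _ => oddCurrent_apply_mem_smoothStates a n)

theorem isQuantumField_current (a : DLieC) : IsQuantumField (current a) :=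
  isQuantumField_iff_eventually.2 fun v =>
    ((smoothStates_eq_top ▸ Submodule.mem_top : v ∈ smoothStates) a).1

theorem isQuantumField_oddCurrent (a : DLieC) : IsQuantumField (oddCurrent a) :=
  isQuantumField_iff_eventually.2 fun v =>
    ((smoothStates_eq_top ▸ Submodule.mem_top : v ∈ smoothStates) a).2

/-- The even currents as quantum fields. -/
def curField : DLieC →ₗ[ℂ] quantumFields States where
  toFun a := ⟨current a, isQuantumField_current a⟩
  map_add' a b := Subtype.ext (funext fun n => current_add a b n)
  map_smul' c a := Subtype.ext (funext fun n => current_smul c a n)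

/-- The odd currents as quantum fields. -/
def barField : DLieC →ₗ[ℂ] quantumFields States where
  toFun a := ⟨oddCurrent a, isQuantumField_oddCurrent a⟩
  map_add' a b := Subtype.ext (funext fun n => oddCurrent_add a b n)
  map_smul' c a := Subtype.ext (funext fun n => oddCurrent_smul c a n)

theorem curField_val (a : DLieC) : (curField a).1 = current a := rfl

theorem barField_val (a : DLieC) : (barField a).1 = oddCurrent a := rfl

theorem currentSystem_states : CurrentSystem pairingC curField barField where
  cur_cur a b n := Subtype.ext <| funext fun k => by
    have index : k + n = 0 ↔ k + (n - 1) = -1 := by omega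
    simp [superComm_apply, curField_val, comm_current_current, oneField_apply, index, add_comm n k]
  cur_bar a b n := Subtype.ext <| funext fun k => by
    simp [superComm_apply, curField_val, barField_val, comm_current_oddCurrent, add_comm n k]
  bar_cur a b n := Subtype.ext <| funext fun k => by
    rw [superComm_apply, one_smul, curField_val, barField_val, ← neg_sub,
      comm_current_oddCurrent, ← lie_skew, shift_apply]
    exact neg_eq_iff_eq_neg.2 (congrArg (fun A => A.1 (k + n)) (map_neg barField ⁅a, b⁆))
  bar_bar a b n := Subtype.ext <| funext fun k => by
    simp [superComm_apply, barField_val, anticomm_oddCurrent_oddCurrent, oneField_apply,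
      add_comm n k]

theorem toEnvelope_smul_mem_stateParity (g : Gen) {q : ZMod 2} {v : States}
    (hv : v ∈ stateParity q) : g.toEnvelope • v ∈ stateParity (g.parity + q) := by
  change v ∈ (stateParity (g.parity + q)).comap (Algebra.lsmul ℂ ℂ States g.toEnvelope)
  refine Submodule.span_le.2 ?_ hv
  rintro _ ⟨l, f, hl, rfl⟩
  refine Submodule.subset_span ⟨g :: l, f, ?_, ?_⟩
  · rw [List.map_cons, List.sum_cons, hl]
  · rw [List.map_cons, List.prod_cons, mul_smul]
    rfl

theorem curField_mem_parityFields (a : DLieC) : curField a ∈ parityFields stateParity 0 :=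
  fun n _ _ hv => toEnvelope_smul_mem_stateParity (.cur a n) hv

theorem barField_mem_parityFields (a : DLieC) : barField a ∈ parityFields stateParity 1 :=
  fun n _ _ hv => toEnvelope_smul_mem_stateParity (.bar a n) hv

end States

/-! ### Manin triples -/

section DualBases

open Module (Basis)

theorem sum_dual_smul {R V ι : Type*} [CommRing R] [AddCommGroup V] [Module R V] [Fintype ι]
    [DecidableEq ι] {l : Submodule R V} (b : Basis ι R l) {f : ι → V →ₗ[R] R}
    (hf : ∀ i k, f k (b i) = if i = k then 1 else 0) (x : l) :
    ∑ i, f i x • (b i : V) = x := by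
  have domRestrict_eq (k : ι) : (f k).domRestrict l = b.coord k :=
    b.ext fun i => by simp [hf, Finsupp.single_apply]
  have apply_eq (k : ι) : f k x = b.repr x k := LinearMap.congr_fun (domRestrict_eq k) x
  have sum_eq := congrArg l.subtype (b.sum_repr x)
  rw [map_sum] at sum_eq
  simpa only [apply_eq, map_smul, Submodule.subtype_apply] using sum_eq

theorem sum_dualBases_eq {R V N ι κ : Type*} [CommRing R] [AddCommGroup V] [Module R V]
    [AddCommGroup N] [Module R N] [Fintype ι] [DecidableEq ι] [Fintype κ] [DecidableEq κ]
    {B : LinearMap.BilinForm R V} {l l' : Submodule R V} (Φ : V →ₗ[R] V →ₗ[R] N)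
    {b : Basis ι R l} {b' : Basis ι R l'} {c : Basis κ R l} {c' : Basis κ R l'}
    (hb : ∀ i k, B (b i) (b' k) = if i = k then 1 else 0)
    (hc : ∀ i k, B (c i) (c' k) = if i = k then 1 else 0) :
    ∑ i, Φ (b' i) (b i) = ∑ i, Φ (c' i) (c i) := by
  have c_eq (k : κ) : ∑ i, B (c k) (b' i) • (b i : V) = c k :=
    sum_dual_smul b (f := fun i => B.flip (b' i)) hb (c k)
  have b'_eq (i : ι) : ∑ k, B (c k) (b' i) • (c' k : V) = b' i :=
    sum_dual_smul c' (f := fun k => B (c k)) (fun i k => by simp [hc, eq_comm]) (b' i)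
  calc ∑ i, Φ (b' i) (b i) = ∑ i, ∑ k, B (c k) (b' i) • Φ (c' k) (b i) := by
        refine Finset.sum_congr rfl fun i _ => ?_
        conv_lhs => rw [← b'_eq i]
        simp only [map_sum, map_smul, LinearMap.sum_apply, LinearMap.smul_apply]
    _ = ∑ k, ∑ i, B (c k) (b' i) • Φ (c' k) (b i) := Finset.sum_comm
    _ = ∑ k, Φ (c' k) (c k) := Finset.sum_congr rfl fun k _ => by
        simp only [← map_smul, ← map_sum, c_eq]

theorem exists_basis_span_image_eq {K V ι : Type*} [Field K] [AddCommGroup V] [Module K V]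
    [FiniteDimensional K V] [Fintype ι] (U : Submodule K V)
    (hι : Fintype.card ι = Module.finrank K V) :
    ∃ (b : Basis ι K V) (s : Set ι), Submodule.span K (b '' s) = U := by
  obtain ⟨t, -, span_t, ht⟩ := exists_linearIndependent K (U : Set V)
  have ht : LinearIndepOn K id t := ht
  let c := Basis.extend ht
  have := FiniteDimensional.fintypeBasisIndex c
  let r := Fintype.equivOfCardEq ((Module.finrank_eq_card_basis c).symm.trans hι.symm)
  refine ⟨c.reindex r, c.reindex r ⁻¹' t, ?_⟩
  rw [Set.image_preimage_eq_of_subset, span_t, Submodule.span_eq]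
  rw [Basis.range_reindex, Basis.range_extend]
  exact Basis.subset_extend ht

end DualBases

namespace IsManinTriple

open Module (Basis)

variable {K 𝔡 : Type*} [Field K] [LieRing 𝔡] [LieAlgebra K 𝔡] [FiniteDimensional K 𝔡]
  {B : LinearMap.BilinForm K 𝔡} {𝔞 𝔟 : Submodule K 𝔡}

theorem bijective_toDual (h : IsManinTriple B 𝔞 𝔟) :
    Function.Bijective (B.flip.compl₁₂ 𝔟.subtype 𝔞.subtype : 𝔟 →ₗ[K] Module.Dual K 𝔞) := by
  have exists_add (z : 𝔡) : ∃ x ∈ 𝔞, ∃ y ∈ 𝔟, x + y = z :=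
    Submodule.mem_sup.1 (h.isCompl.sup_eq_top ▸ Submodule.mem_top)
  constructor
  · refine (injective_iff_map_eq_zero _).2 fun y hy => Subtype.ext (h.nondegenerate.2 _ fun z => ?_)
    obtain ⟨x, hx, y', hy', rfl⟩ := exists_add z
    rw [map_add, LinearMap.add_apply, h.isotropic_right _ hy' _ y.2, add_zero]
    exact LinearMap.congr_fun hy ⟨x, hx⟩
  · intro φ
    obtain ⟨ψ, hψ⟩ := φ.exists_extend
    obtain ⟨x, hx, y, hy, hxy⟩ := exists_add ((B.toDual h.nondegenerate).symm ψ)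
    refine ⟨⟨y, hy⟩, LinearMap.ext fun x' => ?_⟩
    change B x' y = φ x'
    have hψ' := LinearMap.BilinForm.apply_toDual_symm_apply (hB := h.nondegenerate) ψ (x' : 𝔡)
    rw [← hxy, map_add, LinearMap.add_apply, h.isotropic_left _ hx _ x'.2, zero_add] at hψ'
    rw [h.symm, hψ', ← hψ]
    rfl

theorem exists_dualBasis (h : IsManinTriple B 𝔞 𝔟) {ι : Type*} [Finite ι] [DecidableEq ι]
    (e : Basis ι K 𝔞) :
    ∃ e' : Basis ι K 𝔟, ∀ i k, B (e i) (e' k) = if i = k then 1 else 0 := by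
  let toDual := LinearEquiv.ofBijective _ h.bijective_toDual
  refine ⟨e.dualBasis.map toDual.symm, fun i k => ?_⟩
  have h_apply : toDual (toDual.symm (e.dualBasis k)) (e i) = e.dualBasis k (e i) := by
    rw [LinearEquiv.apply_symm_apply]
  rw [Basis.dualBasis_apply_self] at h_apply
  exact h_apply

theorem two_mul_finrank_left (h : IsManinTriple B 𝔞 𝔟) :
    2 * Module.finrank K 𝔞 = Module.finrank K 𝔡 := by
  have finrank_right : Module.finrank K 𝔟 = Module.finrank K 𝔞 :=
    (LinearEquiv.ofBijective _ h.bijective_toDual).finrank_eq.trans Subspace.dual_finrank_eq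
  rw [← Submodule.finrank_add_eq_of_isCompl h.isCompl, finrank_right, two_mul]

end IsManinTriple

/-! ### Orthogonal complex structures on a Lie algebra -/

section OrthogonalComplexStructure

section SquareRootOfNegOne

variable {K V : Type*} [Field K] [NeZero (2 : K)] [AddCommGroup V] [Module K V]
  {j : V →ₗ[K] V} {ε : K}

theorem le_sup_inf_eigenspace (hj : ∀ x, j (j x) = -x) (hε : ε * ε = -1)
    {W : Submodule K V} (hW : ∀ x ∈ W, j x ∈ W) :
    W ≤ (W ⊓ Module.End.eigenspace j ε) ⊔ (W ⊓ Module.End.eigenspace j (-ε)) := by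
  have half_mem (δ : K) (hδ : δ * δ = -1) {x : V} (hx : x ∈ W) :
      (2⁻¹ : K) • (x - δ • j x) ∈ W ⊓ Module.End.eigenspace j δ := by
    refine ⟨W.smul_mem _ (W.sub_mem hx (W.smul_mem _ (hW x hx))), ?_⟩
    rw [SetLike.mem_coe, Module.End.mem_eigenspace_iff, map_smul, map_sub, map_smul, hj]
    linear_combination (norm := module) hδ • (2⁻¹ : K) • j x
  intro x hx
  refine Submodule.mem_sup.2 ⟨_, half_mem ε hε hx, _, half_mem (-ε) (by simpa) hx, ?_⟩
  have h_half : (2⁻¹ : K) + 2⁻¹ = 1 := by rw [← two_mul, mul_inv_cancel₀ two_ne_zero]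
  linear_combination (norm := module) h_half • x

theorem isCompl_eigenspace (hj : ∀ x, j (j x) = -x) (hε : ε * ε = -1) :
    IsCompl (Module.End.eigenspace j ε) (Module.End.eigenspace j (-ε)) := by
  constructor
  · have hε0 : ε ≠ 0 := by rintro rfl; simp at hε
    exact Module.End.disjoint_genEigenspace j
      (fun h_eq => hε0 ((mul_eq_zero.1 (by linear_combination h_eq : 2 * ε = 0)).resolve_left
        two_ne_zero)) 1 1
  · rw [codisjoint_iff_le_sup]
    simpa only [top_inf_eq] using
      le_sup_inf_eigenspace hj hε (W := ⊤) fun _ _ => Submodule.mem_top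

end SquareRootOfNegOne

/-- An invariant orthogonal complex structure on a group, seen at the identity: `j² = -1`, `j`
preserves `B`, and the Nijenhuis tensor of `j` vanishes. -/
structure IsOrthogonalComplexStructure {K 𝔤 : Type*} [CommRing K] [LieRing 𝔤] [LieAlgebra K 𝔤]
    (B : LinearMap.BilinForm K 𝔤) (j : 𝔤 →ₗ[K] 𝔤) : Prop where
  sq : ∀ x, j (j x) = -x
  orth : ∀ x y, B (j x) (j y) = B x y
  nijenhuis : ∀ x y, ⁅j x, j y⁆ - j ⁅j x, y⁆ - j ⁅x, j y⁆ - ⁅x, y⁆ = 0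

namespace IsOrthogonalComplexStructure

theorem skew {K 𝔤 : Type*} [CommRing K] [LieRing 𝔤] [LieAlgebra K 𝔤]
    {B : LinearMap.BilinForm K 𝔤} {j : 𝔤 →ₗ[K] 𝔤} (h : IsOrthogonalComplexStructure B j)
    (x y : 𝔤) : B (j x) y = -B x (j y) := by
  rw [← h.orth x (j y), h.sq, map_neg, neg_neg]

variable {K 𝔤 : Type*} [Field K] [NeZero (2 : K)] [LieRing 𝔤] [LieAlgebra K 𝔤]
  {B : LinearMap.BilinForm K 𝔤} {j : 𝔤 →ₗ[K] 𝔤} {ε : K}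

theorem lie_mem_eigenspace (h : IsOrthogonalComplexStructure B j) (hε : ε * ε = -1)
    {x y : 𝔤} (hx : x ∈ Module.End.eigenspace j ε) (hy : y ∈ Module.End.eigenspace j ε) :
    ⁅x, y⁆ ∈ Module.End.eigenspace j ε := by
  rw [Module.End.mem_eigenspace_iff] at hx hy ⊢
  have nijenhuis_xy := h.nijenhuis x y
  rw [hx, hy] at nijenhuis_xy
  simp only [smul_lie, lie_smul, map_smul, smul_smul, hε] at nijenhuis_xy
  have h_two : (2 * ε) • j ⁅x, y⁆ = (2 * ε) • ε • ⁅x, y⁆ := by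
    rw [smul_smul, mul_assoc, hε]
    linear_combination (norm := module) -nijenhuis_xy
  exact smul_right_injective _ (mul_ne_zero two_ne_zero (by rintro rfl; simp at hε)) h_two

theorem eigenspace_isotropic (h : IsOrthogonalComplexStructure B j) (hε : ε * ε = -1)
    {x y : 𝔤} (hx : x ∈ Module.End.eigenspace j ε) (hy : y ∈ Module.End.eigenspace j ε) :
    B x y = 0 := by
  rw [Module.End.mem_eigenspace_iff] at hx hy
  have orth_xy := h.orth x y
  rw [hx, hy, map_smul, map_smul, LinearMap.smul_apply, smul_smul, hε, smul_eq_mul] at orth_xy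
  have h_two : 2 * B x y = 0 := by linear_combination -orth_xy
  exact (mul_eq_zero.1 h_two).resolve_left two_ne_zero

theorem isManinTriple (h : IsOrthogonalComplexStructure B j) (hε : ε * ε = -1)
    (symm : ∀ x y, B x y = B y x) (nondegenerate : B.Nondegenerate)
    (invariant : ∀ x y z, B ⁅x, y⁆ z = B x ⁅y, z⁆) :
    IsManinTriple B (Module.End.eigenspace j ε) (Module.End.eigenspace j (-ε)) where
  symm := symm
  nondegenerate := nondegenerate
  invariant := invariant
  lie_mem_left _ hx _ hy := h.lie_mem_eigenspace hε hx hy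
  lie_mem_right _ hx _ hy := h.lie_mem_eigenspace (by simpa) hx hy
  isotropic_left _ hx _ hy := h.eigenspace_isotropic hε hx hy
  isotropic_right _ hx _ hy := h.eigenspace_isotropic (by simpa) hx hy
  isCompl := isCompl_eigenspace h.sq hε

end IsOrthogonalComplexStructure

/-- The largest `j`-stable subspace of the centre, when `j² = -1`. -/
def stableCenter {K 𝔤 : Type*} [CommRing K] [LieRing 𝔤] [LieAlgebra K 𝔤] (j : 𝔤 →ₗ[K] 𝔤) :
    Submodule K 𝔤 where
  carrier := {x | ∀ y : 𝔤, ⁅x, y⁆ = 0 ∧ ⁅j x, y⁆ = 0}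
  add_mem' hx hx' y := by simp [hx y, hx' y]
  zero_mem' y := by simp
  smul_mem' c x hx y := by simp [hx y]

namespace IsOrthogonalComplexStructure

variable {K 𝔤 : Type*} [CommRing K] [LieRing 𝔤] [LieAlgebra K 𝔤]
  {B : LinearMap.BilinForm K 𝔤} {j : 𝔤 →ₗ[K] 𝔤}

theorem map_mem_stableCenter (h : IsOrthogonalComplexStructure B j) {x : 𝔤}
    (hx : x ∈ stableCenter j) : j x ∈ stableCenter j := fun y => by
  rw [h.sq, neg_lie, (hx y).1, neg_zero]
  exact ⟨(hx y).2, rfl⟩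

theorem mem_stableCenter_of_orthogonal (h : IsOrthogonalComplexStructure B j)
    (nondegenerate : B.Nondegenerate) (invariant : ∀ x y z, B ⁅x, y⁆ z = B x ⁅y, z⁆)
    (lie_mem : ∀ x y : 𝔤, ⁅x, y⁆ ∈ stableCenter j) {x : 𝔤}
    (hx : ∀ y ∈ stableCenter j, B x y = 0) : x ∈ stableCenter j := by
  -- the orthogonal of `[𝔤, 𝔤]` is the centre
  have central_of_orthogonal {u : 𝔤} (hu : ∀ y z, B u ⁅y, z⁆ = 0) (y : 𝔤) : ⁅u, y⁆ = 0 :=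
    nondegenerate.1 _ fun z => by rw [invariant, hu]
  refine fun y => ⟨central_of_orthogonal (fun y z => hx _ (lie_mem y z)) y,
    central_of_orthogonal (fun y z => ?_) y⟩
  rw [h.skew, hx _ (h.map_mem_stableCenter (lie_mem y z)), neg_zero]

end IsOrthogonalComplexStructure

end OrthogonalComplexStructure

section BaseChange

variable {R A L : Type*} [CommRing R] [CommRing A] [Algebra R A]

theorem baseChange_induction₂ {M : Type*} [AddCommGroup M] [Module R M]
    {P : A ⊗[R] M → A ⊗[R] M → Prop} (x y : A ⊗[R] M)
    (tmul : ∀ a u b v, P (a ⊗ₜ u) (b ⊗ₜ v)) (zero_left : ∀ y, P 0 y) (zero_right : ∀ x, P x 0)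
    (add_left : ∀ x x' y, P x y → P x' y → P (x + x') y)
    (add_right : ∀ x y y', P x y → P x y' → P x (y + y')) : P x y := by
  induction x with
  | zero => exact zero_left y
  | add x x' h h' => exact add_left _ _ _ h h'
  | tmul a u =>
    induction y with
    | zero => exact zero_right _
    | add y y' h h' => exact add_right _ _ _ h h'
    | tmul b v => exact tmul a u b v

variable [LieRing L] [LieAlgebra R L] {B : LinearMap.BilinForm R L} {j : L →ₗ[R] L}

theorem baseChange_invariant (hB : ∀ x y z, B ⁅x, y⁆ z = B x ⁅y, z⁆) (x y z : A ⊗[R] L) :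
    B.baseChange A ⁅x, y⁆ z = B.baseChange A x ⁅y, z⁆ := by
  induction x, y using baseChange_induction₂ with
  | zero_left y => simp
  | zero_right x => simp
  | add_left x x' y h h' => simp [h, h']
  | add_right x y y' h h' => simp [h, h']
  | tmul a u b v =>
    induction z with
    | zero => simp
    | add z z' h h' => simp only [map_add, lie_add, h, h']
    | tmul c w => simp [LinearMap.BilinForm.baseChange_tmul, hB, mul_assoc]

theorem baseChange_map_lie_lie_eq_zero (h : ∀ x y z : L, ⁅j ⁅x, y⁆, z⁆ = 0) (x y z : A ⊗[R] L) :
    ⁅j.baseChange A ⁅x, y⁆, z⁆ = 0 := by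
  induction x, y using baseChange_induction₂ with
  | zero_left y => simp
  | zero_right x => simp
  | add_left x x' y h h' => simp [h, h']
  | add_right x y y' h h' => simp [h, h']
  | tmul a u b v =>
    induction z with
    | zero => simp
    | add z z' h h' => rw [lie_add, h, h', add_zero]
    | tmul c w => simp [h]

theorem IsOrthogonalComplexStructure.baseChange (h : IsOrthogonalComplexStructure B j) :
    IsOrthogonalComplexStructure (B.baseChange A) (j.baseChange A) where
  sq x := by
    induction x with
    | zero => simp
    | add x y hx hy => rw [map_add, map_add, hx, hy, neg_add]
    | tmul a u => simp [h.sq, TensorProduct.tmul_neg]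
  orth x y := by
    induction x, y using baseChange_induction₂ with
    | zero_left y => simp
    | zero_right x => simp
    | add_left x x' y h h' => simp [h, h']
    | add_right x y y' h h' => simp [h, h']
    | tmul a u b v => simp [LinearMap.BilinForm.baseChange_tmul, h.orth]
  nijenhuis x y := by
    induction x, y using baseChange_induction₂ with
    | zero_left y => simp
    | zero_right x => simp
    | add_left x x' y h h' =>
      simp only [map_add, add_lie]
      linear_combination (norm := abel) h + h'
    | add_right x y y' h h' =>
      simp only [map_add, lie_add]
      linear_combination (norm := abel) h + h'
    | tmul a u b v =>
      simp only [LinearMap.baseChange_tmul, LieAlgebra.ExtendScalars.bracket_tmul,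
        ← TensorProduct.tmul_sub, h.nijenhuis, TensorProduct.tmul_zero]

theorem baseChange_nondegenerate {K A V : Type*} [Field K] [CommRing A] [Algebra K A]
    [AddCommGroup V] [Module K V] [FiniteDimensional K V] {B : LinearMap.BilinForm K V}
    (symm : LinearMap.IsSymm B) (hB : B.Nondegenerate) : (B.baseChange A).Nondegenerate := by
  have separatingLeft : (B.baseChange A).SeparatingLeft := fun x hx => by
    let c := Module.finBasis K V
    let b := B.dualBasis hB c
    have repr_eq (x : A ⊗[K] V) (i) :
        (b.baseChange A).repr x i = B.baseChange A x (1 ⊗ₜ c i) := by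
      induction x with
      | zero => simp
      | add x y hx hy => simp [hx, hy]
      | tmul a u => simp [b, LinearMap.BilinForm.baseChange_tmul]
    refine (b.baseChange A).ext_elem fun i => ?_
    rw [repr_eq, hx, map_zero, Finsupp.zero_apply]
  exact ⟨separatingLeft, fun y hy => separatingLeft y fun x => by
    rw [← hy x]; exact (LinearMap.BilinForm.IsSymm.baseChange A symm).eq y x⟩

end BaseChange

namespace IsManinTriple

open Module (Basis)

section

variable {K 𝔡 : Type*} [Field K] [LieRing 𝔡] [LieAlgebra K 𝔡]
  {B : LinearMap.BilinForm K 𝔡} {𝔞 𝔟 : Submodule K 𝔡} {ι : Type*} [Fintype ι] [DecidableEq ι]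

theorem apply_lie_swap (h : IsManinTriple B 𝔞 𝔟) (x y z : 𝔡) : B ⁅x, y⁆ z = -B ⁅x, z⁆ y := by
  rw [h.invariant, ← lie_skew, map_neg, ← h.invariant]

theorem sum_dualBases_smul (h : IsManinTriple B 𝔞 𝔟) {e : Basis ι K 𝔞} {e' : Basis ι K 𝔟}
    (he : ∀ i k, B (e i) (e' k) = if i = k then 1 else 0) (x : 𝔡) :
    ∑ i, (B x (e' i) • (e i : 𝔡) + B x (e i) • (e' i : 𝔡)) = x := by
  obtain ⟨y, hy, z, hz, rfl⟩ : ∃ y ∈ 𝔞, ∃ z ∈ 𝔟, y + z = x :=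
    Submodule.mem_sup.1 (h.isCompl.sup_eq_top ▸ Submodule.mem_top)
  have y_eq : ∑ i, B y (e' i) • (e i : 𝔡) = y :=
    sum_dual_smul e (f := fun i => B.flip (e' i)) he ⟨y, hy⟩
  have z_eq : ∑ i, B z (e i) • (e' i : 𝔡) = z :=
    sum_dual_smul e' (f := fun i => B.flip (e i)) (fun i k => by
      rw [LinearMap.BilinForm.flip_apply, h.symm, he]; simp only [eq_comm]) ⟨z, hz⟩
  simp only [map_add, LinearMap.add_apply, h.isotropic_left _ hy _ (e _).2,
    h.isotropic_right _ hz _ (e' _).2, add_zero, zero_add, Finset.sum_add_distrib, y_eq, z_eq]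

theorem exists_dualBases_piecewise_mem [FiniteDimensional K 𝔡] (h : IsManinTriple B 𝔞 𝔟)
    (hι : Fintype.card ι = Module.finrank K 𝔞) {W : Submodule K 𝔡} (hW : W ≤ (W ⊓ 𝔞) ⊔ (W ⊓ 𝔟))
    (mem_of_orthogonal : ∀ x, (∀ y ∈ W, B x y = 0) → x ∈ W) :
    ∃ (e : Basis ι K 𝔞) (e' : Basis ι K 𝔟) (s : Set ι),
      (∀ i k, B (e i) (e' k) = if i = k then 1 else 0) ∧
      (∀ i ∈ s, (e i : 𝔡) ∈ W) ∧ ∀ i ∉ s, (e' i : 𝔡) ∈ W := by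
  obtain ⟨e, s, span_eq⟩ := exists_basis_span_image_eq (W.submoduleOf 𝔞) hι
  obtain ⟨e', he⟩ := h.exists_dualBasis e
  refine ⟨e, e', s, he, fun i hi => ?_, fun k hk => mem_of_orthogonal _ fun y hy => ?_⟩
  · have mem : e i ∈ W.submoduleOf 𝔞 := span_eq ▸ Submodule.subset_span ⟨i, hi, rfl⟩
    exact mem
  · obtain ⟨u, ⟨huW, hu⟩, v, ⟨-, hv⟩, rfl⟩ := Submodule.mem_sup.1 (hW hy)
    have le_ker : W.submoduleOf 𝔞 ≤ LinearMap.ker ((B (e' k)).domRestrict 𝔞) := by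
      rw [← span_eq, Submodule.span_le]
      rintro _ ⟨i, hi, rfl⟩
      rw [SetLike.mem_coe, LinearMap.mem_ker, LinearMap.domRestrict_apply, h.symm, he,
        if_neg (by rintro rfl; exact hk hi)]
    have hu0 : B (e' k) u = 0 := le_ker (x := ⟨u, hu⟩) huW
    rw [map_add, hu0, h.isotropic_right _ (e' k).2 _ hv, add_zero]

end

theorem adaptedFrame {𝔡 : Type*} [LieRing 𝔡] [LieAlgebra ℂ 𝔡] {B : LinearMap.BilinForm ℂ 𝔡}
    {𝔞 𝔟 : Submodule ℂ 𝔡} {ι : Type*} [Fintype ι] [DecidableEq ι] (h : IsManinTriple B 𝔞 𝔟)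
    {e : Basis ι ℂ 𝔞} {e' : Basis ι ℂ 𝔟} (he : ∀ i k, B (e i) (e' k) = if i = k then 1 else 0)
    (s : Set ι) [DecidablePred (· ∈ s)] {w d : ι → 𝔡}
    (hw : w = s.piecewise (fun i => (e i : 𝔡)) fun i => (e' i : 𝔡))
    (hd : d = s.piecewise (fun i => (e' i : 𝔡)) fun i => (e i : 𝔡))
    (w_lie : ∀ i (x : 𝔡), ⁅w i, x⁆ = 0) :
    AdaptedFrame B (s.piecewise 1 (-1)) (fun i j k => B ⁅d i, d j⁆ (d k)) w d := by
  have e_e (i j : ι) : B (e i) (e j) = 0 := h.isotropic_left _ (e i).2 _ (e j).2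
  have e'_e' (i j : ι) : B (e' i) (e' j) = 0 := h.isotropic_right _ (e' i).2 _ (e' j).2
  have e'_e (i j : ι) : B (e' i) (e j) = if i = j then 1 else 0 := by
    rw [h.symm, he]; simp only [eq_comm]
  have lie_e_e (i j k : ι) : B ⁅(e i : 𝔡), (e j : 𝔡)⁆ (e k) = 0 :=
    h.isotropic_left _ (h.lie_mem_left _ (e i).2 _ (e j).2) _ (e k).2
  have lie_e'_e' (i j k : ι) : B ⁅(e' i : 𝔡), (e' j : 𝔡)⁆ (e' k) = 0 :=
    h.isotropic_right _ (h.lie_mem_right _ (e' i).2 _ (e' j).2) _ (e' k).2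
  have ne_of {i j : ι} (hi : i ∈ s) (hj : j ∉ s) : i ≠ j := ne_of_mem_of_not_mem hi hj
  have eq_sum (x : 𝔡) (hx : ∀ k, B x (w k) = 0) : x = ∑ k, B x (d k) • w k := by
    refine (h.sum_dualBases_smul he x).symm.trans (Finset.sum_congr rfl fun k _ => ?_)
    specialize hx k
    by_cases hk : k ∈ s <;> simp only [hw, hd, hk, Set.piecewise_eq_of_mem,
      Set.piecewise_eq_of_notMem, not_false_eq_true] at hx ⊢ <;>
      rw [hx, zero_smul]
    exacts [add_zero _, zero_add _]
  refine ⟨w_lie, fun i j => eq_sum _ fun k => ?_, fun i j => ?_, fun i j => ?_, fun i j => ?_,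
    fun i j => ?_, fun i j k => ?_, fun i j k => h.apply_lie_swap _ _ _, fun i => ?_,
    fun i j k => ?_⟩
  · rw [h.invariant, ← lie_skew, w_lie, neg_zero, map_zero]
  iterate 4
    by_cases hi : i ∈ s <;> by_cases hj : j ∈ s <;>
      simp [hw, hd, hi, hj, he, e_e, e'_e', e'_e, ne_of, (ne_of _ _).symm]
  · rw [← lie_skew, map_neg, LinearMap.neg_apply]
  · by_cases hi : i ∈ s <;> simp [hi]
  · by_cases hi : i ∈ s <;> by_cases hj : j ∈ s <;> by_cases hk : k ∈ s <;>
      simp [hd, hi, hj, hk, lie_e_e, lie_e'_e']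

end IsManinTriple

/-! ### Left-invariant complex structures -/

section LeftInvariant

theorem pairing_apply (x y : DLie) :
    pairing x y = ∑ i, (x.1 i * y.2 i + x.2 i * y.1 i) := rfl

theorem pairing_comm (x y : DLie) : pairing x y = pairing y x := by
  simp only [pairing_apply]
  exact Finset.sum_congr rfl fun i _ => by ring

theorem pairing_lie (x y z : DLie) : pairing ⁅x, y⁆ z = pairing x ⁅y, z⁆ := by
  change ∑ i, (detForm x.2 y.2 i * z.2 i + 0 * z.1 i) = ∑ i, (x.1 i * 0 + x.2 i * detForm y.2 z.2 i)
  simp [Fin.sum_univ_four, detForm]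
  ring

/-- The basis vector `αⁱ`. -/
def alpha (i : Fin 4) : DLie := ((Pi.single i 1, 0) : (Fin 4 → ℝ) × (Fin 4 → ℝ))

/-- The basis vector `βᵢ`. -/
def beta (i : Fin 4) : DLie := ((0, Pi.single i 1) : (Fin 4 → ℝ) × (Fin 4 → ℝ))

theorem pairing_alpha (x : DLie) (i : Fin 4) : pairing x (alpha i) = x.2 i := by
  change ∑ k, (x.1 k * 0 + x.2 k * Pi.single (M := fun _ => ℝ) i 1 k) = x.2 i
  simp [Pi.single_apply]

theorem pairing_beta (x : DLie) (i : Fin 4) : pairing x (beta i) = x.1 i := by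
  change ∑ k, (x.1 k * Pi.single (M := fun _ => ℝ) i 1 k + x.2 k * 0) = x.1 i
  simp [Pi.single_apply]

theorem alpha_lie (i : Fin 4) (x : DLie) : ⁅alpha i, x⁆ = 0 :=
  Prod.ext (detForm_zero_left _) rfl

theorem lie_alpha (x : DLie) (i : Fin 4) : ⁅x, alpha i⁆ = 0 :=
  Prod.ext (detForm_zero_right _) rfl

theorem pairing_nondegenerate : pairing.Nondegenerate := by
  have separatingLeft : pairing.SeparatingLeft := fun x hx => Prod.ext
    (funext fun i => (pairing_beta x i).symm.trans (hx _))
    (funext fun i => (pairing_alpha x i).symm.trans (hx _))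
  exact ⟨separatingLeft, fun y hy => separatingLeft y fun x => by rw [pairing_comm, hy]⟩

theorem eq_sum_alpha {x : DLie} (hx : x.2 = 0) : x = ∑ i, x.1 i • alpha i := by
  refine sub_eq_zero.1 (pairing_nondegenerate.1 _ fun y => ?_)
  rw [map_sub, map_sum, LinearMap.sub_apply, LinearMap.sum_apply, pairing_apply, hx]
  simp [pairing_comm _ y, pairing_alpha]

/-- The operator `ad x` of the Lie algebra, as a continuous map. -/
def adjointMap (x : DLie) : DLie →L[ℝ] DLie :=
  LinearMap.toContinuousLinearMap (LieAlgebra.ad ℝ DLie x : DLie →ₗ[ℝ] DLie)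

theorem adjointMap_apply (x y : DLie) : adjointMap x y = ⁅x, y⁆ := rfl

/-- The left-invariant vector field with value `u` at the identity. -/
def invField (u : DLie) : DLie → DLie := fun x => u - (1 / 2 : ℝ) • adjointMap u x

theorem invField_zero (u : DLie) : invField u 0 = u := by
  simp [invField]

theorem contDiff_invField (u : DLie) : ContDiff ℝ ∞ (invField u) := by
  unfold invField; fun_prop

theorem fderiv_invField (u x v : DLie) : fderiv ℝ (invField u) x v = (1 / 2 : ℝ) • ⁅v, u⁆ := by
  have h_eq : fderiv ℝ (invField u) x = -((1 / 2 : ℝ) • adjointMap u) := by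
    unfold invField
    rw [fderiv_const_sub]
    exact congrArg Neg.neg ((1 / 2 : ℝ) • adjointMap u).fderiv
  rw [h_eq, ← lie_skew v u, smul_neg]
  rfl

theorem dLeft_apply (h : DGroup) (x u : DLie) : dLeft h x u = invField u h.log := by
  have mul_eq : (fun y : DLie => (h * ⟨y⟩).log) =
      fun y => h.log + (ContinuousLinearMap.id ℝ DLie + (1 / 2 : ℝ) • adjointMap h.log) y := by
    funext y
    exact add_assoc _ _ _
  rw [dLeft, mul_eq, fderiv_const_add, ContinuousLinearMap.fderiv, invField, adjointMap_apply,
    ← lie_skew, smul_neg, sub_neg_eq_add]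
  rfl

theorem lieBracket_invField (u v : DLie) :
    VectorField.lieBracket ℝ (invField u) (invField v) 0 = ⁅u, v⁆ := by
  rw [VectorField.lieBracket_eq]
  simp only [invField_zero, fderiv_invField]
  rw [← lie_skew u v]
  module

theorem IsEquivariant.apply_invField {𝒥 : DLie → DLie →L[ℝ] DLie} (h : IsEquivariant 𝒥)
    (u x : DLie) : 𝒥 x (invField u x) = invField (𝒥 0 u) x := by
  have h_dLeft := congrArg (fun T : DLie →L[ℝ] DLie => T u) (h ⟨x⟩ 0)
  simp only [ContinuousLinearMap.comp_apply, dLeft_apply] at h_dLeft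
  rw [mul_log] at h_dLeft
  simpa using h_dLeft.symm

theorem isOrthogonalComplexStructure_atIdentity {𝒥 : DLie → DLie →L[ℝ] DLie}
    (h𝒥 : IsComplexStructure 𝒥) (heq : IsEquivariant 𝒥) (horth : IsOrthogonal 𝒥) :
    IsOrthogonalComplexStructure pairing (𝒥 0 : DLie →ₗ[ℝ] DLie) where
  sq x := congrArg (fun T : DLie →L[ℝ] DLie => T x) (h𝒥.sq 0)
  orth x y := by
    have dLeft_one (u : DLie) : dLeft (DGroup.exp 0)⁻¹ 0 u = u := by
      rw [dLeft_apply]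
      exact (congrArg (invField u) neg_zero).trans (invField_zero u)
    have orth_zero := horth 0 x y
    simp only [metric, dLeft_one] at orth_zero
    exact orth_zero
  nijenhuis u v := by
    have integrable_uv := h𝒥.integrable (invField u) (invField v) (contDiff_invField u)
      (contDiff_invField v) 0
    simp only [heq.apply_invField, lieBracket_invField] at integrable_uv
    exact integrable_uv

section Central

variable {j : DLie →ₗ[ℝ] DLie}

theorem map_alpha_antisymm (h : IsOrthogonalComplexStructure pairing j) (i k : Fin 4) :
    (j (alpha i)).2 k = -(j (alpha k)).2 i := by
  rw [← pairing_alpha, ← pairing_alpha, h.skew, pairing_comm]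

theorem detForm_map_alpha (h : IsOrthogonalComplexStructure pairing j) (i k : Fin 4) :
    detForm (j (alpha i)).2 (j (alpha k)).2 = 0 := by
  have nijenhuis_alpha := h.nijenhuis (alpha i) (alpha k)
  rw [alpha_lie, alpha_lie, lie_alpha, map_zero, sub_zero, sub_zero, sub_zero] at nijenhuis_alpha
  exact congrArg Prod.fst nijenhuis_alpha

theorem eq_zero_of_antisymm_of_detForm {A : Fin 4 → Fin 4 → ℝ} (antisymm : ∀ i k, A i k = -A k i)
    (parallel : ∀ i k, detForm (A i) (A k) = 0) {i k : Fin 4} (hi : i ≠ 0) (hk : k ≠ 0) :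
    A i k = 0 := by
  have diag (i : Fin 4) : A i i = 0 := self_eq_neg.1 (antisymm i i)
  have transpose {i k : Fin 4} (h : A i k = 0) : A k i = 0 := by rw [antisymm, h, neg_zero]
  have cross {i k l : Fin 4} (hl : detForm (A i) (A k) l = 0)
      (minor : detForm (A i) (A k) l = A i i * A k k - A i k * A k i) : A i k = 0 := by
    rw [hl, diag, antisymm k i] at minor
    exact mul_self_eq_zero.1 (by linarith)
  have zero₁₂ : A 1 2 = 0 := cross (congrFun (parallel 1 2) 3) rfl
  have zero₃₁ : A 3 1 = 0 := cross (congrFun (parallel 3 1) 2) rfl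
  have zero₂₃ : A 2 3 = 0 := cross (congrFun (parallel 2 3) 1) rfl
  fin_cases i <;> fin_cases k <;>
    first
    | exact absurd rfl hi
    | exact absurd rfl hk
    | exact diag _
    | assumption
    | exact transpose (by assumption)

theorem lie_map_lie_eq_zero (h : IsOrthogonalComplexStructure pairing j) (x y z : DLie) :
    ⁅j ⁅x, y⁆, z⁆ = 0 := by
  have map_alpha_lie (i : Fin 4) (hi : i ≠ 0) : ⁅j (alpha i), z⁆ = 0 := by
    have snd_eq (k : Fin 4) (hk : k ≠ 0) : (j (alpha i)).2 k = 0 :=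
      eq_zero_of_antisymm_of_detForm (map_alpha_antisymm h) (detForm_map_alpha h) hi hk
    refine Prod.ext (funext fun k => ?_) rfl
    change detForm (j (alpha i)).2 z.2 k = 0
    fin_cases k <;> simp [detForm, snd_eq]
  rw [eq_sum_alpha (x := ⁅x, y⁆) rfl, map_sum, sum_lie]
  refine Finset.sum_eq_zero fun i _ => ?_
  rw [map_smul, smul_lie]
  obtain rfl | hi := eq_or_ne i 0
  · exact zero_smul ℝ _
  · rw [map_alpha_lie i hi, smul_zero]

theorem isManinTriple_eigenspace (h : IsOrthogonalComplexStructure pairing j) {ε : ℂ}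
    (hε : ε * ε = -1) : IsManinTriple pairingC (Module.End.eigenspace (j.baseChange ℂ) ε)
      (Module.End.eigenspace (j.baseChange ℂ) (-ε)) :=
  h.baseChange.isManinTriple hε
    (LinearMap.BilinForm.IsSymm.baseChange ℂ ⟨pairing_comm⟩).eq
    (baseChange_nondegenerate ⟨pairing_comm⟩ pairing_nondegenerate)
    (baseChange_invariant pairing_lie)

theorem finrank_DLieC : Module.finrank ℂ DLieC = 8 := by
  have finrank_DLie : Module.finrank ℝ DLie = 8 := by
    change Module.finrank ℝ ((Fin 4 → ℝ) × (Fin 4 → ℝ)) = 8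
    simp
  rw [Module.finrank_baseChange, finrank_DLie]

theorem exists_dualBases_piecewise_central (h : IsOrthogonalComplexStructure pairing j) {ε : ℂ}
    (hε : ε * ε = -1) :
    ∃ (e : Module.Basis (Fin 4) ℂ (Module.End.eigenspace (j.baseChange ℂ) ε))
      (e' : Module.Basis (Fin 4) ℂ (Module.End.eigenspace (j.baseChange ℂ) (-ε)))
      (s : Set (Fin 4)), (∀ i k, pairingC (e i) (e' k) = if i = k then 1 else 0) ∧
        (∀ i ∈ s, ∀ x : DLieC, ⁅(e i : DLieC), x⁆ = 0) ∧
        ∀ i ∉ s, ∀ x : DLieC, ⁅(e' i : DLieC), x⁆ = 0 := by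
  have manin := isManinTriple_eigenspace h hε
  have lie_mem (x y : DLieC) : ⁅x, y⁆ ∈ stableCenter (j.baseChange ℂ) := fun z =>
    ⟨by simpa using
        baseChange_map_lie_lie_eq_zero (A := ℂ) (j := LinearMap.id) lie_lie_eq_zero x y z,
      baseChange_map_lie_lie_eq_zero (lie_map_lie_eq_zero h) x y z⟩
  have card_eq : Fintype.card (Fin 4)
      = Module.finrank ℂ (Module.End.eigenspace (j.baseChange ℂ) ε) := by
    have two_mul_finrank := manin.two_mul_finrank_left.trans finrank_DLieC
    exact Nat.eq_of_mul_eq_mul_left two_pos two_mul_finrank.symm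
  obtain ⟨e, e', s, dual, he, he'⟩ := manin.exists_dualBases_piecewise_mem
    (W := stableCenter (j.baseChange ℂ)) card_eq
    (le_sup_inf_eigenspace h.baseChange.sq hε fun x hx => h.baseChange.map_mem_stableCenter hx)
    (fun x hx => h.baseChange.mem_stableCenter_of_orthogonal manin.nondegenerate manin.invariant
      lie_mem hx)
  exact ⟨e, e', s, dual, fun i hi x => (he i hi x).1, fun i hi x => (he' i hi x).1⟩

end Central

end LeftInvariant

/-! ### The superfield of dual bases -/

namespace IsN2

variable {M : Type*} [AddCommGroup M] [Module ℂ M] {S : ZMod 2 → Submodule ℂ M} {c : ℂ}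
  {D D' : N2Data M}

theorem comm_J_zero_sub (h : IsN2 S c D) (n : ℤ) :
    D.J 0 * (D.Gm - D.Gp) n - (D.Gm - D.Gp) n * D.J 0 = -(D.Gm n + D.Gp n) := by
  have hJGp := hasOPE_singleton_iff.1 h.JGp 0 n
  have hJGm := hasOPE_singleton_iff.1 h.JGm 0 n
  rw [koszul_zero_left, one_smul, zero_add] at hJGp hJGm
  rw [Pi.neg_apply] at hJGm
  rw [Pi.sub_apply, mul_sub, sub_mul]
  linear_combination (norm := abel) hJGm - hJGp

theorem anticomm_Gp_zero (h : IsN2 S c D) (n : ℤ) :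
    D.Gp 0 * D.Gm n + D.Gm n * D.Gp 0 = D.L n + (1 / 2 : ℂ) • dField D.J n := by
  simpa [koszul_one_one] using hasOPE_triple_iff.1 h.GpGm 0 n

theorem eq_of_superfield_eq (h : IsN2 S c D) (h' : IsN2 S c D') (hJ : D.J = D'.J)
    (hG : D.Gm - D.Gp = D'.Gm - D'.Gp) : D = D' := by
  have add_eq (n : ℤ) : D.Gm n + D.Gp n = D'.Gm n + D'.Gp n := by
    rw [← neg_inj, ← h.comm_J_zero_sub, ← h'.comm_J_zero_sub, hJ, hG]
  have sub_eq (n : ℤ) : D.Gm n - D.Gp n = D'.Gm n - D'.Gp n := congrFun hG n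
  have hGm : D.Gm = D'.Gm := funext fun n => by
    linear_combination (norm := module) (1 / 2 : ℂ) • add_eq n + (1 / 2 : ℂ) • sub_eq n
  have hGp : D.Gp = D'.Gp := funext fun n => by
    linear_combination (norm := module) (1 / 2 : ℂ) • add_eq n - (1 / 2 : ℂ) • sub_eq n
  have hL : D.L = D'.L := funext fun n => by
    have hGpGm := h.anticomm_Gp_zero n
    rw [hGm, hGp, hJ, h'.anticomm_Gp_zero n] at hGpGm
    exact (add_right_cancel hGpGm).symm
  cases D
  cases D'
  simp_all only

end IsN2

section Superfield

section Components

variable {M : Type*} [AddCommGroup M] [Module ℂ M] {𝔡 : Type*} [LieRing 𝔡] [LieAlgebra ℂ 𝔡]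
  {ι : Type*} [Fintype ι]

/-- The component `∑ᵢ :ēⁱ ēᵢ:` of the superfield of two families of vectors. -/
def lowerField (bar : 𝔡 →ₗ[ℂ] quantumFields M) (e e' : ι → 𝔡) : quantumFields M :=
  ∑ i, normalProd (-1) (bar (e' i)) (bar (e i))

/-- The coefficient `∑ᵢ (:eⁱ ēᵢ: - :ēⁱ eᵢ:)` of `θ` in the superfield of two families of
vectors. -/
def upperField (cur bar : 𝔡 →ₗ[ℂ] quantumFields M) (e e' : ι → 𝔡) : quantumFields M :=
  ∑ i, (normalProd 1 (cur (e' i)) (bar (e i)) - normalProd 1 (bar (e' i)) (cur (e i)))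

namespace CurrentSystem

variable {B : LinearMap.BilinForm ℂ 𝔡} {cur bar : 𝔡 →ₗ[ℂ] quantumFields M}

theorem jField_piecewise (hc : CurrentSystem B cur bar) (e e' : ι → 𝔡) (s : Set ι)
    [DecidablePred (· ∈ s)] :
    jField bar (s.piecewise 1 (-1)) (s.piecewise e e') (s.piecewise e' e)
      = lowerField bar e e' := by
  refine Finset.sum_congr rfl fun i _ => ?_
  by_cases hi : i ∈ s
  · simp [hi]
  · simp only [hi, not_false_eq_true, Set.piecewise_eq_of_notMem, Pi.neg_apply, Pi.one_apply]
    rw [normalProd_swap (by norm_num) (hc.bar_bar (e' i) (e i))]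
    module

theorem hField_piecewise (hc : CurrentSystem B cur bar) {e e' : ι → 𝔡}
    (lie_eq_zero : ∀ i, ⁅e i, e' i⁆ = 0) (s : Set ι) [DecidablePred (· ∈ s)] :
    hField cur bar (s.piecewise 1 (-1)) (s.piecewise e e') (s.piecewise e' e)
      = upperField cur bar e e' := by
  have swap (i : ι) : normalProd 1 (bar (e' i)) (cur (e i))
      = normalProd 1 (cur (e i)) (bar (e' i)) := by
    rw [normalProd_swap (mul_one 1) (hasContraction_zero_iff.2 fun n => by
      rw [hc.cur_bar, lie_eq_zero, map_zero, map_zero]), one_smul]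
  refine Finset.sum_congr rfl fun i _ => ?_
  rw [swap]
  by_cases hi : i ∈ s
  · simp [hi]
  · simp only [hi, not_false_eq_true, Set.piecewise_eq_of_notMem, Pi.neg_apply, Pi.one_apply]
    module

end CurrentSystem

end Components

theorem isGeneratedBy_iff (D : N2Data States) (e e' : Fin 4 → DLieC) :
    IsGeneratedBy D e e' ↔ D.J = (lowerField barField e e').1 ∧
      D.Gm - D.Gp = (upperField curField barField e e').1 := by
  have bar_bar (x y : DLieC) (n : ℤ) (v : States) : normalOrd 1 1 (oddCurrent x) (oddCurrent y) n v
      = (normalProd (-1) (barField x) (barField y)).1 n v := by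
    rw [← koszul_one_one]
    exact normalOrd_eq_normalProd 1 1 (barField x) (barField y) n v
  have cur_bar (x y : DLieC) (n : ℤ) (v : States) : normalOrd 0 1 (current x) (oddCurrent y) n v
      = (normalProd 1 (curField x) (barField y)).1 n v := by
    rw [← koszul_zero_left 1]
    exact normalOrd_eq_normalProd 0 1 (curField x) (barField y) n v
  have bar_cur (x y : DLieC) (n : ℤ) (v : States) : normalOrd 1 0 (oddCurrent x) (current y) n v
      = (normalProd 1 (barField x) (curField y)).1 n v := by
    rw [← koszul_zero_right 1]
    exact normalOrd_eq_normalProd 1 0 (barField x) (curField y) n v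
  simp only [IsGeneratedBy, bar_bar, cur_bar, bar_cur, funext_iff, LinearMap.ext_iff]
  simp [lowerField, upperField, LinearMap.sum_apply]

theorem isGeneratedBy_iff_of_dualBases {𝔞 𝔟 : Submodule ℂ DLieC}
    {b c : Module.Basis (Fin 4) ℂ 𝔞} {b' c' : Module.Basis (Fin 4) ℂ 𝔟}
    (hb : ∀ i k, pairingC (b i) (b' k) = if i = k then 1 else 0)
    (hc : ∀ i k, pairingC (c i) (c' k) = if i = k then 1 else 0) (D : N2Data States) :
    IsGeneratedBy D (fun i => (b i : DLieC)) (fun i => (b' i : DLieC)) ↔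
      IsGeneratedBy D (fun i => (c i : DLieC)) (fun i => (c' i : DLieC)) := by
  have sum_eq (ε : ℂ) (f g : DLieC →ₗ[ℂ] quantumFields States) :
      ∑ i, normalProd ε (f (b' i)) (g (b i)) = ∑ i, normalProd ε (f (c' i)) (g (c i)) :=
    sum_dualBases_eq ((normalProd ε).compl₁₂ f g) hb hc
  simp only [isGeneratedBy_iff, lowerField, upperField, Finset.sum_sub_distrib, sum_eq]

theorem IsN2.eq_of_isGeneratedBy {S : ZMod 2 → Submodule ℂ States} {c : ℂ} {D D' : N2Data States}
    (h : IsN2 S c D) (h' : IsN2 S c D') {e e' : Fin 4 → DLieC} (hD : IsGeneratedBy D e e')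
    (hD' : IsGeneratedBy D' e e') : D = D' := by
  rw [isGeneratedBy_iff] at hD hD'
  exact h.eq_of_superfield_eq h' (hD.1.trans hD'.1.symm) (hD.2.trans hD'.2.symm)

/-- The four fields attached to a frame of `𝔡`. -/
def adaptedData {ι : Type*} [Fintype ι] (σ : ι → ℂ) (F : ι → ι → ι → ℂ) (w d : ι → DLieC) :
    N2Data States :=
  n2Data (jField barField σ w d).1 (kField curField barField σ F w d).1
    (hField curField barField σ w d).1 (sField curField barField σ F w d).1

theorem AdaptedFrame.isN2_adaptedData {ι : Type*} [Fintype ι] [DecidableEq ι] {σ : ι → ℂ}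
    {F : ι → ι → ι → ℂ} {w d : ι → DLieC} (hb : AdaptedFrame pairingC σ F w d) :
    IsN2 stateParity (3 * Fintype.card ι) (adaptedData σ F w d) :=
  have closed := isProductClosed_parityFields stateParity
  (currentSystem_states.seed hb).isN2 stateParity
    (closed.sField_mem curField_mem_parityFields barField_mem_parityFields σ F w d)
    (closed.jField_mem barField_mem_parityFields σ w d)
    (closed.kField_mem curField_mem_parityFields barField_mem_parityFields σ F w d)
    (closed.hField_mem curField_mem_parityFields barField_mem_parityFields σ w d)

theorem isInAffineVertexAlgebra_adaptedData {ι : Type*} [Fintype ι] (σ : ι → ℂ)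
    (F : ι → ι → ι → ℂ) (w d : ι → DLieC) :
    IsInAffineVertexAlgebra (adaptedData σ F w d) :=
  have closed := isProductClosed_generatedFields current oddCurrent
  have hcur (x : DLieC) : curField x ∈ generatedFields current oddCurrent 0 := .even x
  have hbar (x : DLieC) : barField x ∈ generatedFields current oddCurrent 1 := .odd x
  have hK := closed.kField_mem hcur hbar σ F w d
  have hH := closed.hField_mem hcur hbar σ w d
  { mem_L := closed.sField_mem hcur hbar σ F w d
    mem_J := closed.jField_mem hbar σ w d
    mem_Gp := Submodule.smul_mem _ _ (sub_mem hK hH)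
    mem_Gm := Submodule.smul_mem _ _ (sub_mem hK (neg_mem hH)) }

theorem isGeneratedBy_adaptedData {e e' : Fin 4 → DLieC} (lie_eq_zero : ∀ i, ⁅e i, e' i⁆ = 0)
    (s : Set (Fin 4)) [DecidablePred (· ∈ s)] (F : Fin 4 → Fin 4 → Fin 4 → ℂ) :
    IsGeneratedBy (adaptedData (s.piecewise 1 (-1)) F (s.piecewise e e') (s.piecewise e' e))
      e e' := by
  rw [isGeneratedBy_iff, ← currentSystem_states.jField_piecewise e e' s,
    ← currentSystem_states.hField_piecewise lie_eq_zero s]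
  refine ⟨rfl, ?_⟩
  simp only [adaptedData, n2Data, chiral]
  module

theorem exists_isN2_isGeneratedBy {𝔞 𝔟 : Submodule ℂ DLieC} (h : IsManinTriple pairingC 𝔞 𝔟)
    {e : Module.Basis (Fin 4) ℂ 𝔞} {e' : Module.Basis (Fin 4) ℂ 𝔟}
    (dual : ∀ i k, pairingC (e i) (e' k) = if i = k then 1 else 0) {s : Set (Fin 4)}
    (left_central : ∀ i ∈ s, ∀ x : DLieC, ⁅(e i : DLieC), x⁆ = 0)
    (right_central : ∀ i ∉ s, ∀ x : DLieC, ⁅(e' i : DLieC), x⁆ = 0) :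
    ∃ D, IsN2 stateParity 12 D ∧ IsInAffineVertexAlgebra D ∧
      IsGeneratedBy D (fun i => (e i : DLieC)) (fun i => (e' i : DLieC)) := by
  classical
  have frame := h.adaptedFrame dual s rfl rfl fun i x => by
    by_cases hi : i ∈ s
    · rw [Set.piecewise_eq_of_mem _ _ _ hi, left_central i hi]
    · rw [Set.piecewise_eq_of_notMem _ _ _ hi, right_central i hi]
  have lie_eq_zero (i : Fin 4) : ⁅(e i : DLieC), (e' i : DLieC)⁆ = 0 := by
    by_cases hi : i ∈ s
    · exact left_central i hi _
    · rw [← lie_skew, right_central i hi, neg_zero]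
  have isN2 := frame.isN2_adaptedData
  norm_num at isN2
  exact ⟨_, isN2, isInAffineVertexAlgebra_adaptedData _ _ _ _,
    isGeneratedBy_adaptedData lie_eq_zero s _⟩

end Superfield

end DoubledTorus

end

open DoubledTorus in
theorem mainTheorem2 (𝒥 : DLie → DLie →L[ℝ] DLie)
    (h𝒥 : IsComplexStructure 𝒥) (heq : IsEquivariant 𝒥) (horth : IsOrthogonal 𝒥) :
    IsManinTriple pairingC (eigen 𝒥 Complex.I) (eigen 𝒥 (-Complex.I)) ∧
    ∃! D : N2Data States,
      IsN2 stateParity 12 D ∧ IsInAffineVertexAlgebra D ∧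
      ∀ (e : Module.Basis (Fin 4) ℂ (eigen 𝒥 Complex.I))
        (e' : Module.Basis (Fin 4) ℂ (eigen 𝒥 (-Complex.I))),
        (∀ i j, pairingC (e i) (e' j) = if i = j then 1 else 0) →
        IsGeneratedBy D (fun i => (e i : DLieC)) (fun i => (e' i : DLieC)) := by
  have hj := isOrthogonalComplexStructure_atIdentity h𝒥 heq horth
  have manin := isManinTriple_eigenspace hj Complex.I_mul_I
  obtain ⟨b, b', s, dual, left_central, right_central⟩ :=
    exists_dualBases_piecewise_central hj Complex.I_mul_I
  obtain ⟨D, isN2, inAffine, generated⟩ :=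
    exists_isN2_isGeneratedBy manin dual left_central right_central
  refine ⟨manin, D, ⟨isN2, inAffine, fun e e' he => ?_⟩, fun D' ⟨isN2', _, generated'⟩ => ?_⟩
  · exact (isGeneratedBy_iff_of_dualBases he dual D).2 generated
  · exact isN2'.eq_of_isGeneratedBy isN2 (generated' b b' dual) generated
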